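/- **Setting.** For $f\in L^2(\mathbb R)$ let $\widehat f=\mathcal F f$ be the Fourier transform normalised by $\widehat f(p)=\int_{\mathbb R}f(x)e^{-ixp}\,dx$ on Schwartz functions. Let $k\ge 5$ and $l\ge 4$ be integers and let $p_1<p_2$ and $a<b$ be real numbers with $0\notin[p_1,p_2]$. Let $u_0\in H^3(\mathbb R)$ be such that $\widehat{u_0}$ is a $\mathcal C^k$-function on $\mathbb R$ with $\operatorname{supp}\widehat{u_0}\subseteq[p_1,p_2]$, and let $V\in L^2(\mathbb R)$ (complex-valued) be such that $\widehat V$ is a $\mathcal C^l$-function on $\mathbb R$ with $\operatorname{supp}\widehat V\subseteq[a,b]$. Put $$S_1(t)f:=\mathcal F^{-1}\big(e^{-itp^2}\widehat f(p)\big),\qquad (Bf)(x):=-i\,V(x)f(x),\qquad S_2(t)u_0:=\int_0^t S_1(t-\tau)\,B\,S_1(\tau)u_0\,d\tau ,$$ the last one being a Bochner integral of $L^2(\mathbb R)$-valued functions, and for $t\ge 0$, $p\in\mathbb R$ $$W(t,p):=-\frac{i}{2\pi}\int_0^t\Big(\int_a^b\widehat V(y)\,\widehat{u_0}(p-y)\,e^{-i\tau(p-y)^2}\,dy\Big)e^{i\tau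 p^2}\,d\tau .$$ For $q_1<q_2$ let $\mathfrak C(q_1,q_2):=\{(t,x)\in(0,\infty)\times\mathbb R : 2q_1\le x/t\le 2q_2\}$ and let $\mathfrak C(q_1,q_2)^c$ be its complement in $(0,\infty)\times\mathbb R$. Let $\|g\|_{W^{m,\infty}}:=\max_{0\le j\le m}\|g^{(j)}\|_{L^\infty(\mathbb R)}$. Fix $\delta_1\in(\tfrac12,1)$ and $\delta_2\in(2,\tfrac52)$, and put $\kappa:=\Big(\frac{3\sqrt\pi}{8}+\sqrt{\frac{9\pi}{64}+\frac12}\Big)^{2\delta_2-4}(b-a)^{5-2\delta_2}$, $m:=\max\{|a|,|b|\}$, $$M_1:=(b-a)+\frac{5\,\kappa}{(5-2\delta_2)(\delta_2-1)},\qquad M_2:=M_1+m\,(b-a)+\frac{(12+30m)\,\kappa}{(15-6\delta_2)(\delta_2-2)},$$ $$K:=\frac{1}{(4-4\delta_1)\sqrt\pi}\Big(\frac1{2\sqrt\pi}+\sqrt{\frac1{4\pi}+\frac12}\Big)^{2\delta_1-1}\big((p_2-p_1)+(b-a)\big)^{2-2\delta_1},$$ $$c_1:=\Big(\frac1{2\sqrt\pi}+K\Big)(M_1+M_2),\qquad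 c_2:=K\,M_2 .$$ **Theorem.** The constants $c_1,c_2$ are positive. For every $t\ge0$ the integral defining $S_2(t)u_0$ exists, $S_2(t)u_0$ has a continuous representative, denoted $x\mapsto (S_2(t)u_0)(x)$, and $\operatorname{supp}W(t,\cdot)\subseteq[p_1+a,p_2+b]$. Moreover: 1. for all $t\ge1$, $$\|S_2(t)u_0\|_{L^\infty(\mathbb R)}\le c_1\,\|\widehat V\|_{W^{4,\infty}}\|\widehat{u_0}\|_{W^{5,\infty}}\,t^{-1/2};$$ 2. for all $(t,x)\in\mathfrak C(p_1+a,p_2+b)$, $$\Big|(S_2(t)u_0)(x)-\frac1{2\sqrt\pi}\,e^{-i\pi/4}\,e^{i\frac{x^2}{4t}}\,W\Big(t,\frac{x}{2t}\Big)t^{-1/2}\Big|\le c_2\,\|\widehat V\|_{W^{4,\infty}}\|\widehat{u_0}\|_{W^{5,\infty}}\,t^{-\delta_1};$$ 3. for all $(t,x)\in\mathfrak C(p_1+a,p_2+b)^c$, $$\big|(S_2(t)u_0)(x)\big|\le c_2\,\|\widehat V\|_{W^{4,\infty}}\|\widehat{u_0}\|_{W^{5,\infty}}\,t^{-\delta_1}.$$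 -/

import Mathlib

/-- The complex Hilbert space `L²(ℝ)`. -/
abbrev L2R : Type := MeasureTheory.Lp ℂ 2 (MeasureTheory.volume : MeasureTheory.Measure ℝ)

/-- Membership in the Sobolev space `H³(ℝ)`. -/
def InH3 (f : L2R) : Prop :=
  TemperedDistribution.MemSobolev 3 2 (MeasureTheory.Lp.toTemperedDistribution f)

/-- The Fourier transform on `L²(ℝ)`, normalised by `f̂(p) = ∫ f(x) exp(-i x p) dx` on Schwartz
functions, as a function defined up to null sets. Mathlib's transform is
`∫ f(x) exp(-2 π i x ξ) dx`, hence the substitution `ξ = p / (2 π)`. -/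
noncomputable def hatL2 (f : L2R) : ℝ → ℂ :=
  fun p => MeasureTheory.Lp.fourierTransformₗᵢ ℝ ℂ f (p / (2 * Real.pi))

/-- `g` is the `C^k` representative of the Fourier transform of `f`, and `supp g ⊆ [a, b]`:
the function `f` lies in the bounded frequency band `[a, b]` with regularity `k`. -/
structure InFrequencyBand (k : ℕ) (a b : ℝ) (f : L2R) (g : ℝ → ℂ) : Prop where
  contDiff : ContDiff ℝ k g
  support_subset : tsupport g ⊆ Set.Icc a b
  ae_eq_hat : g =ᵐ[MeasureTheory.volume] hatL2 f

open Classical in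
/-- Multiplication of `f ∈ L²(ℝ)` by a function `m`, on its maximal domain
(with the value `0` outside of the domain `{f | m f ∈ L²}`). -/
noncomputable def mulL2 (m : ℝ → ℂ) (f : L2R) : L2R :=
  if h : MeasureTheory.MemLp (fun x => m x * f x) 2 MeasureTheory.volume then h.toLp else 0

/-- The free Schrödinger evolution `S₁(t) f`, the function whose Fourier transform is
`exp(-i t p²) f̂(p)`; in Mathlib's frequency variable `ξ`, `p = 2 π ξ`. -/
noncomputable def S1 (t : ℝ) (f : L2R) : L2R :=
  (MeasureTheory.Lp.fourierTransformₗᵢ ℝ ℂ).symm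
    (mulL2 (fun ξ => Complex.exp (-Complex.I * t * (2 * Real.pi * ξ) ^ 2))
      (MeasureTheory.Lp.fourierTransformₗᵢ ℝ ℂ f))

/-- The operator `(B f)(x) = -i V(x) f(x)`. -/
noncomputable def potentialOp (V : L2R) (f : L2R) : L2R :=
  mulL2 (fun x => -Complex.I * V x) f

/-- The integrand `τ ↦ S₁(t - τ) B S₁(τ) u₀` of the second Dyson-Phillips term. -/
noncomputable def S2Integrand (V u₀ : L2R) (t τ : ℝ) : L2R :=
  S1 (t - τ) (potentialOp V (S1 τ u₀))

/-- The second Dyson-Phillips term `S₂(t) u₀ = ∫₀ᵗ S₁(t - τ) B S₁(τ) u₀ dτ` (Bochner integral). -/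
noncomputable def S2 (V u₀ : L2R) (t : ℝ) : L2R :=
  ∫ τ in (0 : ℝ)..t, S2Integrand V u₀ t τ

/-- The amplitude
`W(t, p) = -(i / 2π) ∫₀ᵗ (∫ₐᵇ V̂(y) û₀(p - y) exp(-i τ (p - y)²) dy) exp(i τ p²) dτ`. -/
noncomputable def amplitudeW (Vhat uhat : ℝ → ℂ) (a b t p : ℝ) : ℂ :=
  -(Complex.I / (2 * Real.pi)) *
    ∫ τ in (0 : ℝ)..t,
      (∫ y in a..b, Vhat y * uhat (p - y) * Complex.exp (-Complex.I * τ * (p - y) ^ 2)) *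
        Complex.exp (Complex.I * τ * p ^ 2)

/-- The space-time cone of the points `(t, x)` with `t > 0` and `2 q₁ ≤ x / t ≤ 2 q₂`. -/
def cone (q₁ q₂ : ℝ) : Set (ℝ × ℝ) :=
  {z | 0 < z.1 ∧ 2 * q₁ ≤ z.2 / z.1 ∧ z.2 / z.1 ≤ 2 * q₂}

/-- The complement of the cone in `(0, ∞) × ℝ`. -/
def coneCompl (q₁ q₂ : ℝ) : Set (ℝ × ℝ) :=
  {z | 0 < z.1} \ cone q₁ q₂

/-- The norm of `W^{m,∞}(ℝ)`, `max_{j ≤ m} ‖g^{(j)}‖_{L^∞}`, for functions `g` of class `C^m`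
with compact support (whose weak derivatives up to order `m` are the classical ones). -/
noncomputable def sobolevInftyNorm (m : ℕ) (g : ℝ → ℂ) : ℝ :=
  ((Finset.range (m + 1)).sup
    (fun j => MeasureTheory.eLpNorm (iteratedDeriv j g) ⊤ MeasureTheory.volume)).toReal

/-- The first constant bounding the amplitude; `δ₂` is a free parameter in `(2, 5/2)`. -/
noncomputable def constM1 (δ₂ a b : ℝ) : ℝ :=
  (b - a) + 5 / ((5 - 2 * δ₂) * (δ₂ - 1)) *
    (3 * √Real.pi / 8 + √(9 * Real.pi / 64 + 1 / 2)) ^ (2 * δ₂ - 4) * (b - a) ^ (5 - 2 * δ₂)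

/-- The second constant bounding the amplitude; `δ₂` is a free parameter in `(2, 5/2)`. -/
noncomputable def constM2 (δ₂ a b : ℝ) : ℝ :=
  (b - a) + 5 / ((5 - 2 * δ₂) * (δ₂ - 1)) *
    (3 * √Real.pi / 8 + √(9 * Real.pi / 64 + 1 / 2)) ^ (2 * δ₂ - 4) * (b - a) ^ (5 - 2 * δ₂)
  + max |a| |b| * (b - a)
  + 1 / ((15 - 6 * δ₂) * (δ₂ - 2)) *
    (3 * √Real.pi / 8 + √(9 * Real.pi / 64 + 1 / 2)) ^ (2 * δ₂ - 4) * (b - a) ^ (5 - 2 * δ₂) *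
      (12 + 30 * max |a| |b|)

/-- The constant of the stationary phase remainder, for an interval of length `L`. -/
noncomputable def constK (δ₁ L : ℝ) : ℝ :=
  1 / ((4 - 4 * δ₁) * √Real.pi) *
    (1 / (2 * √Real.pi) + √(1 / (4 * Real.pi) + 1 / 2)) ^ (2 * δ₁ - 1) * L ^ (2 - 2 * δ₁)

/-- The constant in the `L^∞` estimate. -/
noncomputable def constC1 (δ₁ δ₂ a b p₁ p₂ : ℝ) : ℝ :=
  (1 / (2 * √Real.pi) + constK δ₁ ((p₂ - p₁) + (b - a))) * (constM1 δ₂ a b + constM2 δ₂ a b)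

/-- The constant in the estimates inside and outside the cone. -/
noncomputable def constC2 (δ₁ δ₂ a b p₁ p₂ : ℝ) : ℝ :=
  constK δ₁ ((p₂ - p₁) + (b - a)) * constM2 δ₂ a b

/-! In frequency space the free evolutions become phases and multiplication by V becomes a
convolution, so the transform of S₂(t)u₀ is exp(-itp²) W(t,p) (`dysonRepr_ae_eq`). Completing the
square in the inverse transform leaves the phase exp(-it(p-p₀)²) with p₀ = x/(2t) and amplitude
W(t,·). Stationary phase, uniform in p₀ (`norm_integral_mul_cexp_sq_sub_le`), yields the leading
term in W(t,p₀) t^(-1/2) and a remainder of order t^(-δ₁) governed by sup |∂ₚW|. Outside the cone p₀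
lies off the support of W, so only the remainder survives; the triangle inequality gives the global
bound.

What must be shown is that W and ∂ₚW are bounded uniformly in t (`norm_amplitudeW_le`,
`norm_deriv_amplitudeW_le`). The inner integral over y has stationary point y = p, which the factor
û₀(p-y) excludes because 0 is not in [p₁,p₂]. Four integrations by parts give decay τ^(-δ₂)
(`norm_integral_conv_cexp_le`). Differentiating in p costs one factor τ, so δ₂ > 2 is what makes the
time integral converge, while δ₂ < 5/2 keeps the weight z^(-(2δ₂-4)) integrable at 0.

Both oscillatory estimates rest on `fresnelKernel`, the iterated antiderivatives of exp(-itz²)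
obtained by rotating the contour, which turns them into absolutely convergent Gaussian moments. For
z > 0 they satisfy a uniform bound and a bound by 1/z with an extra t^(-1/2); interpolation produces
the exponents δ₁ and δ₂. -/

open MeasureTheory Set Filter Topology

/-! ### Moments of the rotated Gaussian. -/

/-- The primitive eighth root of unity `exp(i π / 4)`. -/
noncomputable def eighthRoot : ℂ := ((√2 / 2 : ℝ) : ℂ) * (1 + Complex.I)

theorem eighthRoot_sq : eighthRoot ^ 2 = Complex.I := by
  have h : ((√2 / 2 : ℝ) : ℂ) ^ 2 = 1 / 2 := by
    rw [← Complex.ofReal_pow, div_pow, Real.sq_sqrt (by norm_num)]; norm_num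
  rw [eighthRoot, mul_pow, h]
  linear_combination (1 / 2 : ℂ) * Complex.I_sq

theorem eighthRoot_re : eighthRoot.re = √2 / 2 := by
  simp [eighthRoot]

theorem eighthRoot_ne_zero : eighthRoot ≠ 0 := by
  intro h
  have := eighthRoot_sq
  rw [h] at this
  exact Complex.I_ne_zero (by rw [← this]; norm_num)

theorem norm_eighthRoot : ‖eighthRoot‖ = 1 := by
  have h : ‖eighthRoot‖ ^ 2 = 1 := by rw [← norm_pow, eighthRoot_sq, Complex.norm_I]
  exact (pow_eq_one_iff_of_nonneg (norm_nonneg _) two_ne_zero).1 h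

theorem inv_eighthRoot : eighthRoot⁻¹ = Complex.exp (-Complex.I * Real.pi / 4) := by
  have h : Complex.exp (Complex.I * Real.pi / 4) = eighthRoot := by
    rw [show Complex.I * Real.pi / 4 = ((Real.pi / 4 : ℝ) : ℂ) * Complex.I by push_cast; ring,
      Complex.exp_mul_I, ← Complex.ofReal_cos, ← Complex.ofReal_sin, Real.cos_pi_div_four,
      Real.sin_pi_div_four, eighthRoot]
    ring
  rw [← h, ← Complex.exp_neg]
  congr 1
  ring

/-- The integrand of the moments of the rotated Gaussian. -/
noncomputable def momentIntegrand (t : ℝ) (n : ℕ) (z r : ℝ) : ℂ :=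
  (r : ℂ) ^ n * Complex.exp (-(t : ℂ) * r ^ 2 - 2 * eighthRoot * t * z * r)

/-- The moments `∫₀^∞ rⁿ exp(-t r² - 2 ω t z r) dr`, where `ω = exp(i π / 4)`. -/
noncomputable def rotatedMoment (t : ℝ) (n : ℕ) (z : ℝ) : ℂ :=
  ∫ r in Ioi (0 : ℝ), momentIntegrand t n z r

theorem continuous_momentIntegrand (t : ℝ) (n : ℕ) (z : ℝ) :
    Continuous (momentIntegrand t n z) := by
  unfold momentIntegrand
  fun_prop

theorem norm_momentIntegrand (t : ℝ) (n : ℕ) (z : ℝ) {r : ℝ} (hr : 0 < r) :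
    ‖momentIntegrand t n z r‖ = r ^ n * Real.exp (-t * r ^ 2 - √2 * t * z * r) := by
  rw [momentIntegrand, norm_mul, norm_pow, Complex.norm_real, Real.norm_of_nonneg hr.le,
    Complex.norm_exp]
  congr 2
  have h : -(t : ℂ) * r ^ 2 - 2 * eighthRoot * t * z * r
      = ((-t * r ^ 2 : ℝ) : ℂ) - ((2 * t * z * r : ℝ) : ℂ) * eighthRoot := by push_cast; ring
  rw [h, Complex.sub_re, Complex.ofReal_re, Complex.re_ofReal_mul, eighthRoot_re]
  ring

theorem integrable_exp_quadratic {t : ℝ} (ht : 0 < t) (c : ℝ) :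
    Integrable fun r : ℝ => Real.exp (-t * r ^ 2 + c * r) := by
  have h := (integrable_cexp_quadratic (b := t) (by simpa using ht) c 0).norm
  refine h.congr (Eventually.of_forall fun r => ?_)
  simp only [Complex.norm_exp]
  congr 1
  have h : -(t : ℂ) * r ^ 2 + c * r + 0 = ((-t * r ^ 2 + c * r : ℝ) : ℂ) := by push_cast; ring
  rw [h, Complex.ofReal_re]

/-- Serves as a dominating function locally uniformly in z, of either sign; the power of r is
absorbed by n! exp(r). -/
theorem norm_momentIntegrand_le {t : ℝ} (ht : 0 < t) (n : ℕ) {z C : ℝ} (hz : |z| ≤ C) {r : ℝ}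
    (hr : 0 < r) : ‖momentIntegrand t n z r‖ ≤
      n.factorial * Real.exp (-t * r ^ 2 + (√2 * t * C + 1) * r) := by
  rw [norm_momentIntegrand t n z hr]
  have h1 : r ^ n ≤ n.factorial * Real.exp r := by
    have := Real.pow_div_factorial_le_exp r hr.le n
    rwa [div_le_iff₀ (by positivity), mul_comm] at this
  have h2 : Real.exp (-t * r ^ 2 - √2 * t * z * r) ≤ Real.exp (-t * r ^ 2 + √2 * t * C * r) := by
    apply Real.exp_le_exp.2
    have : -z ≤ C := (neg_le_abs z).trans hz
    have h3 : 0 ≤ √2 * t * r := by positivity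
    nlinarith [mul_le_mul_of_nonneg_left this h3]
  calc r ^ n * Real.exp (-t * r ^ 2 - √2 * t * z * r)
      ≤ (n.factorial * Real.exp r) * Real.exp (-t * r ^ 2 + √2 * t * C * r) := by gcongr
    _ = _ := by rw [mul_assoc, ← Real.exp_add]; ring_nf

theorem integrableOn_momentIntegrand {t : ℝ} (ht : 0 < t) (n : ℕ) (z : ℝ) :
    IntegrableOn (momentIntegrand t n z) (Ioi 0) := by
  refine Integrable.mono' ((integrable_exp_quadratic ht
    (√2 * t * |z| + 1)).const_mul (n.factorial : ℝ)).integrableOn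
    (continuous_momentIntegrand t n z).aestronglyMeasurable ?_
  exact (ae_restrict_mem measurableSet_Ioi).mono fun r hr =>
    norm_momentIntegrand_le ht n le_rfl hr

theorem hasDerivAt_rotatedMoment {t : ℝ} (ht : 0 < t) (n : ℕ) (z : ℝ) :
    HasDerivAt (rotatedMoment t n) (-2 * eighthRoot * t * rotatedMoment t (n + 1) z) z := by
  have key := hasDerivAt_integral_of_dominated_loc_of_deriv_le
    (μ := volume.restrict (Ioi (0 : ℝ))) (F := momentIntegrand t n)
    (F' := fun z r => -2 * eighthRoot * t * momentIntegrand t (n + 1) z r) (x₀ := z)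
    (bound := fun r => ‖-2 * eighthRoot * t‖ * ((n + 1).factorial *
      Real.exp (-t * r ^ 2 + (√2 * t * (|z| + 1) + 1) * r)))
    (Metric.ball_mem_nhds z one_pos)
    (Eventually.of_forall fun x => (continuous_momentIntegrand t n x).aestronglyMeasurable)
    (integrableOn_momentIntegrand ht n z)
    ((continuous_momentIntegrand t (n + 1) z).const_mul _).aestronglyMeasurable ?_ ?_ ?_
  · have := key.2
    rwa [integral_const_mul] at this
  · filter_upwards [ae_restrict_mem measurableSet_Ioi] with r hr x hx
    rw [norm_mul]
    gcongr
    refine norm_momentIntegrand_le ht (n + 1) ?_ hr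
    rw [Metric.mem_ball, Real.dist_eq] at hx
    have := abs_sub_abs_le_abs_sub x z
    linarith
  · exact (((integrable_exp_quadratic ht _).const_mul _).const_mul _).integrableOn
  · filter_upwards with r x _
    unfold momentIntegrand
    have h : HasDerivAt (fun x : ℝ => -(t : ℂ) * r ^ 2 - 2 * eighthRoot * t * x * r)
        (-(2 * eighthRoot * t * 1 * r)) x :=
      (((Complex.ofRealCLM.hasDerivAt (x := x)).const_mul (2 * eighthRoot * t)).mul_const
        (r : ℂ)).const_sub (-(t : ℂ) * r ^ 2)
    convert! h.cexp.const_mul ((r : ℂ) ^ n) using 1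
    ring

/-- Integrate the r-derivative of the (n+1)-st integrand over the half-line: it vanishes at both
ends. -/
theorem rotatedMoment_recursion {t : ℝ} (ht : 0 < t) (n : ℕ) (z : ℝ) :
    2 * t * rotatedMoment t (n + 2) z + 2 * eighthRoot * t * z * rotatedMoment t (n + 1) z
      = (n + 1) * rotatedMoment t n z := by
  have hd : ∀ r ∈ Ici (0 : ℝ), HasDerivAt (momentIntegrand t (n + 1) z)
      ((n + 1) * momentIntegrand t n z r - (2 * t * momentIntegrand t (n + 2) z r +
        2 * eighthRoot * t * z * momentIntegrand t (n + 1) z r)) r := by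
    intro r _
    unfold momentIntegrand
    have h0 := Complex.ofRealCLM.hasDerivAt (x := r)
    have h : HasDerivAt (fun x : ℝ => -(t : ℂ) * x ^ 2 - 2 * eighthRoot * t * z * x)
        (-(t : ℂ) * (2 * r) - 2 * eighthRoot * t * z) r := by
      have := ((h0.pow 2).const_mul (-(t : ℂ))).sub (h0.const_mul (2 * eighthRoot * t * z))
      convert! this using 1
      simp
    convert! (h0.pow (n + 1)).mul h.cexp using 1
    simp
    ring
  have hi := fun k => integrableOn_momentIntegrand ht k z
  have hI : IntegrableOn (fun r => (n + 1) * momentIntegrand t n z r -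
      (2 * t * momentIntegrand t (n + 2) z r +
        2 * eighthRoot * t * z * momentIntegrand t (n + 1) z r)) (Ioi 0) :=
    ((hi n).const_mul _).sub (((hi (n + 2)).const_mul _).add ((hi (n + 1)).const_mul _))
  have h := integral_Ioi_of_hasDerivAt_of_tendsto' hd hI
    (tendsto_zero_of_hasDerivAt_of_integrableOn_Ioi (fun x hx => hd x (Ioi_subset_Ici_self hx)) hI (hi (n + 1)))
  have hadd : IntegrableOn (fun r => 2 * t * momentIntegrand t (n + 2) z r +
      2 * eighthRoot * t * z * momentIntegrand t (n + 1) z r) (Ioi 0) :=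
    ((hi (n + 2)).const_mul _).add ((hi (n + 1)).const_mul _)
  rw [integral_sub ((hi n).const_mul _) hadd,
    integral_add ((hi (n + 2)).const_mul _) ((hi (n + 1)).const_mul _), integral_const_mul,
    integral_const_mul, integral_const_mul] at h
  simp only [momentIntegrand, ne_eq, Complex.ofReal_zero, Nat.add_eq_zero_iff, one_ne_zero,
    and_false, not_false_eq_true, zero_pow, zero_mul, sub_self] at h
  simp only [rotatedMoment, momentIntegrand]
  linear_combination -h

/-- Same argument with the integrand of order 0, which equals 1 at r = 0; this boundary value is the
right-hand side. -/
theorem rotatedMoment_recursion_zero {t : ℝ} (ht : 0 < t) (z : ℝ) :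
    2 * t * rotatedMoment t 1 z + 2 * eighthRoot * t * z * rotatedMoment t 0 z = 1 := by
  have hd : ∀ r ∈ Ici (0 : ℝ), HasDerivAt (momentIntegrand t 0 z)
      (-(2 * t * momentIntegrand t 1 z r +
        2 * eighthRoot * t * z * momentIntegrand t 0 z r)) r := by
    intro r _
    unfold momentIntegrand
    have h0 := Complex.ofRealCLM.hasDerivAt (x := r)
    have h : HasDerivAt (fun x : ℝ => -(t : ℂ) * x ^ 2 - 2 * eighthRoot * t * z * x)
        (-(t : ℂ) * (2 * r) - 2 * eighthRoot * t * z) r := by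
      have := ((h0.pow 2).const_mul (-(t : ℂ))).sub (h0.const_mul (2 * eighthRoot * t * z))
      convert! this using 1
      simp
    convert! h.cexp.const_mul 1 using 1
    simp
    ring
  have hi := fun k => integrableOn_momentIntegrand ht k z
  have hI : IntegrableOn (fun r => -(2 * t * momentIntegrand t 1 z r +
        2 * eighthRoot * t * z * momentIntegrand t 0 z r)) (Ioi 0) :=
    (((hi 1).const_mul _).add ((hi 0).const_mul _)).neg
  have h := integral_Ioi_of_hasDerivAt_of_tendsto' hd hI
    (tendsto_zero_of_hasDerivAt_of_integrableOn_Ioi (fun x hx => hd x (Ioi_subset_Ici_self hx)) hI (hi 0))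
  rw [integral_neg, integral_add ((hi 1).const_mul _) ((hi 0).const_mul _), integral_const_mul,
    integral_const_mul] at h
  simp only [momentIntegrand, pow_zero, Complex.ofReal_zero, mul_zero, ne_eq, OfNat.ofNat_ne_zero,
    not_false_eq_true, zero_pow, sub_self, Complex.exp_zero] at h
  simp only [rotatedMoment, momentIntegrand, pow_zero]
  linear_combination -h

/-! ### Fresnel kernels and their pointwise bounds. -/

/-- The iterated antiderivatives of `z ↦ exp(-i t z²)` decaying on the positive half-line. -/
noncomputable def fresnelKernel (t : ℝ) (n : ℕ) (z : ℝ) : ℂ :=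
  (eighthRoot⁻¹) ^ (n + 1) / n.factorial * Complex.exp (-Complex.I * t * z ^ 2) *
    rotatedMoment t n z

theorem hasDerivAt_cexp_sq (t z : ℝ) :
    HasDerivAt (fun z : ℝ => Complex.exp (-Complex.I * t * z ^ 2))
      (-2 * Complex.I * t * z * Complex.exp (-Complex.I * t * z ^ 2)) z := by
  have h0 := Complex.ofRealCLM.hasDerivAt (x := z)
  convert! ((h0.pow 2).const_mul (-Complex.I * t)).cexp using 1
  simp
  ring

/-- Heuristically the kernel is the integral of exp(-itζ²) from z to infinity along the ray ζ = z +
r/ω, where i/ω = ω and i/ω² = 1. The moment recursion verifies the derivative directly, without a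
contour shift. -/
theorem hasDerivAt_fresnelKernel_zero {t : ℝ} (ht : 0 < t) (z : ℝ) :
    HasDerivAt (fresnelKernel t 0) (-Complex.exp (-Complex.I * t * z ^ 2)) z := by
  unfold fresnelKernel
  have h := ((hasDerivAt_cexp_sq t z).const_mul
    ((eighthRoot⁻¹) ^ (0 + 1) / (Nat.factorial 0 : ℂ))).mul (hasDerivAt_rotatedMoment ht 0 z)
  convert! h using 1
  have hr := rotatedMoment_recursion_zero ht z
  have hω := eighthRoot_ne_zero
  have h2 := eighthRoot_sq
  simp only [zero_add, pow_one, Nat.factorial_zero, Nat.cast_one, div_one]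
  field_simp
  linear_combination eighthRoot * hr - 2 * t * z * rotatedMoment t 0 z * h2

/-- Along the same ray this kernel is the Cauchy repeated integral with weight (ζ-z)^n / n!, which
explains the normalisation. -/
theorem hasDerivAt_fresnelKernel_succ {t : ℝ} (ht : 0 < t) (n : ℕ) (z : ℝ) :
    HasDerivAt (fresnelKernel t (n + 1)) (-fresnelKernel t n z) z := by
  have h := ((hasDerivAt_cexp_sq t z).const_mul
    ((eighthRoot⁻¹) ^ (n + 1 + 1) / ((n + 1).factorial : ℂ))).mul
      (hasDerivAt_rotatedMoment ht (n + 1) z)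
  convert! h using 1
  have hr := rotatedMoment_recursion ht n z
  have hω := eighthRoot_ne_zero
  have h2 := eighthRoot_sq
  have hn : ((n.factorial : ℕ) : ℂ) ≠ 0 := Nat.cast_ne_zero.2 n.factorial_ne_zero
  have hn1 : ((n : ℂ) + 1) ≠ 0 := Nat.cast_add_one_ne_zero n
  rw [fresnelKernel]
  simp only [Nat.factorial_succ, Nat.cast_mul, Nat.cast_add, Nat.cast_one]
  rw [pow_succ _ (n + 1)]
  field_simp
  linear_combination eighthRoot * hr -
    2 * t * z * rotatedMoment t (n + 1) z * h2

theorem continuous_fresnelKernel {t : ℝ} (ht : 0 < t) (n : ℕ) : Continuous (fresnelKernel t n) := by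
  cases n with
  | zero => exact continuous_iff_continuousAt.2 fun z =>
      (hasDerivAt_fresnelKernel_zero ht z).continuousAt
  | succ n => exact continuous_iff_continuousAt.2 fun z =>
      (hasDerivAt_fresnelKernel_succ ht n z).continuousAt

theorem norm_fresnelKernel (t : ℝ) (n : ℕ) (z : ℝ) :
    ‖fresnelKernel t n z‖ = ‖rotatedMoment t n z‖ / n.factorial := by
  have h : ‖Complex.exp (-Complex.I * t * z ^ 2)‖ = 1 := by
    rw [show -Complex.I * t * z ^ 2 = ((-t * z ^ 2 : ℝ) : ℂ) * Complex.I by push_cast; ring,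
      Complex.norm_exp_ofReal_mul_I]
  rw [fresnelKernel, norm_mul, norm_mul, h, norm_div, norm_pow, norm_inv, norm_eighthRoot]
  simp
  ring

theorem norm_rotatedMoment_le {t : ℝ} (n : ℕ) (z : ℝ) {f : ℝ → ℝ} {c : ℝ}
    (hf : IntegrableOn f (Ioi 0)) (hc : ∫ r in Ioi (0 : ℝ), f r = c)
    (h : ∀ r, 0 < r → r ^ n * Real.exp (-t * r ^ 2 - √2 * t * z * r) ≤ f r) :
    ‖rotatedMoment t n z‖ ≤ c := by
  rw [← hc]
  refine norm_integral_le_of_norm_le hf ?_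
  filter_upwards [ae_restrict_mem measurableSet_Ioi] with r hr
  rw [norm_momentIntegrand t n z hr]
  exact h r hr

theorem integrableOn_pow_mul_exp_neg_sq {t : ℝ} (ht : 0 < t) (n : ℕ) :
    IntegrableOn (fun r : ℝ => r ^ n * Real.exp (-t * r ^ 2)) (Ioi 0) := by
  have h : IntegrableOn (fun r => ‖momentIntegrand t n 0 r‖) (Ioi 0) :=
    (integrableOn_momentIntegrand ht n 0).norm
  refine h.congr_fun (fun r hr => ?_) measurableSet_Ioi
  simp only [norm_momentIntegrand t n 0 hr]
  simp

theorem integral_pow_mul_exp_neg_sq {t : ℝ} (ht : 0 < t) (n : ℕ) :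
    ∫ r in Ioi (0 : ℝ), r ^ n * Real.exp (-t * r ^ 2) =
      t ^ (-((n : ℝ) + 1) / 2) * (1 / 2) * Real.Gamma (((n : ℝ) + 1) / 2) := by
  have := integral_rpow_mul_exp_neg_mul_rpow (p := 2) (q := n) (b := t) (by norm_num)
    (by linarith [n.cast_nonneg (α := ℝ)]) ht
  rw [← this]
  simp

theorem fresnelKernel_zero_at_zero (t : ℝ) :
    fresnelKernel t 0 0 = eighthRoot⁻¹ * (√(Real.pi / t) / 2 : ℝ) := by
  have h : rotatedMoment t 0 0 = ((√(Real.pi / t) / 2 : ℝ) : ℂ) := by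
    rw [← integral_gaussian_Ioi, ← integral_complex_ofReal]
    refine integral_congr_ae (Eventually.of_forall fun r => ?_)
    simp [momentIntegrand]
  rw [fresnelKernel, h]
  simp

theorem mul_exp_neg_le_one (x : ℝ) : x * Real.exp (-x) ≤ 1 := by
  rw [Real.exp_neg, ← div_eq_mul_inv, div_le_one (Real.exp_pos x)]
  linarith [Real.add_one_le_exp x]

theorem exp_quadratic_le {t z r : ℝ} (ht : 0 < t) (hz : 0 ≤ z) (hr : 0 < r) :
    Real.exp (-t * r ^ 2 - √2 * t * z * r) ≤ Real.exp (-t * r ^ 2) :=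
  Real.exp_le_exp.2 (by have : 0 ≤ √2 * t * z * r := by positivity
                        linarith)

theorem norm_fresnelKernel_zero_le {t z : ℝ} (ht : 0 < t) (hz : 0 ≤ z) :
    ‖fresnelKernel t 0 z‖ ≤ √Real.pi / 2 * t ^ (-(1 / 2) : ℝ) := by
  rw [norm_fresnelKernel, Nat.factorial_zero, Nat.cast_one, div_one]
  refine norm_rotatedMoment_le 0 z (integrableOn_pow_mul_exp_neg_sq ht 0) ?_ fun r hr => ?_
  · rw [integral_pow_mul_exp_neg_sq ht, Nat.cast_zero, zero_add, Real.Gamma_one_half_eq]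
    norm_num
    ring
  · exact mul_le_mul_of_nonneg_left (exp_quadratic_le ht hz hr) (by positivity)

/-- Drop the Gaussian and keep exp(-√2 t z r), available because Re ω = √2/2. -/
theorem norm_fresnelKernel_zero_le_div {t z : ℝ} (ht : 0 < t) (hz : 0 < z) :
    ‖fresnelKernel t 0 z‖ ≤ 1 / √2 * t ^ (-1 : ℝ) * z⁻¹ := by
  rw [norm_fresnelKernel, Nat.factorial_zero, Nat.cast_one, div_one]
  have h0 : 0 < √2 * t * z := by positivity
  refine norm_rotatedMoment_le (f := fun r => Real.exp (-(√2 * t * z) * r)) 0 z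
    (exp_neg_integrableOn_Ioi 0 h0) ?_ fun r hr => ?_
  · rw [integral_exp_mul_Ioi (by linarith), Real.rpow_neg_one]
    simp
    ring
  · rw [pow_zero, one_mul]
    exact Real.exp_le_exp.2 (by nlinarith [mul_pos ht (pow_pos hr 2)])

theorem norm_fresnelKernel_three_le {t z : ℝ} (ht : 0 < t) (hz : 0 ≤ z) :
    ‖fresnelKernel t 3 z‖ ≤ 1 / 12 * t ^ (-2 : ℝ) := by
  rw [norm_fresnelKernel, div_le_iff₀ (by positivity)]
  refine norm_rotatedMoment_le 3 z (integrableOn_pow_mul_exp_neg_sq ht 3) ?_ fun r hr => ?_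
  · rw [integral_pow_mul_exp_neg_sq ht]
    norm_num [Nat.factorial]
    ring
  · exact mul_le_mul_of_nonneg_left (exp_quadratic_le ht hz hr) (by positivity)

/-- The inequality r exp(-cr) ≤ 1/c with c = √2 t z trades one power of r for 1/z. The constant
√π/(24√2) is weakened to 1/12 to agree with the uniform bound, so that interpolation keeps 1/12. -/
theorem norm_fresnelKernel_three_le_div {t z : ℝ} (ht : 0 < t) (hz : 0 < z) :
    ‖fresnelKernel t 3 z‖ ≤ 1 / 12 * t ^ (-(5 / 2) : ℝ) * z⁻¹ := by
  have h0 : 0 < √2 * t * z := by positivity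
  have hb : ‖rotatedMoment t 3 z‖ ≤ (√2 * t * z)⁻¹ * (t ^ (-(3 / 2) : ℝ) * (1 / 2) * (√Real.pi / 2)) := by
    refine norm_rotatedMoment_le 3 z ((integrableOn_pow_mul_exp_neg_sq ht 2).const_mul
      (√2 * t * z)⁻¹) ?_ fun r hr => ?_
    · have hG : Real.Gamma (3 / 2) = √Real.pi / 2 := by
        rw [show (3 / 2 : ℝ) = 1 / 2 + 1 by norm_num, Real.Gamma_add_one (by norm_num),
          Real.Gamma_one_half_eq]
        ring
      rw [integral_const_mul, integral_pow_mul_exp_neg_sq ht, ← hG]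
      norm_num
    · rw [sub_eq_add_neg, Real.exp_add]
      have h1 := mul_exp_neg_le_one (√2 * t * z * r)
      have h2 : r * Real.exp (-(√2 * t * z * r)) ≤ (√2 * t * z)⁻¹ := by
        rw [inv_eq_one_div, le_div_iff₀ h0]
        linarith
      calc r ^ 3 * (Real.exp (-t * r ^ 2) * Real.exp (-(√2 * t * z * r)))
          = (r * Real.exp (-(√2 * t * z * r))) * (r ^ 2 * Real.exp (-t * r ^ 2)) := by ring
        _ ≤ _ := by gcongr
  rw [norm_fresnelKernel, div_le_iff₀ (by positivity)]
  refine hb.trans ?_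
  have ht' : t ^ (-(5 / 2) : ℝ) = t ^ (-(3 / 2) : ℝ) * t⁻¹ := by
    rw [← Real.rpow_neg_one t, ← Real.rpow_add ht]
    norm_num
  have hπ : √Real.pi ≤ 2 := by
    rw [Real.sqrt_le_left (by norm_num)]
    linarith [Real.pi_le_four]
  have h2 : (√2)⁻¹ ≤ 1 := inv_le_one_of_one_le₀ (by rw [Real.one_le_sqrt]; norm_num)
  rw [ht', mul_inv, mul_inv]
  have hq : 0 ≤ t ^ (-(3 / 2) : ℝ) * t⁻¹ * z⁻¹ := by positivity
  calc (√2)⁻¹ * t⁻¹ * z⁻¹ * (t ^ (-(3 / 2) : ℝ) * (1 / 2) * (√Real.pi / 2))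
      = ((√2)⁻¹ * √Real.pi / 4) * (t ^ (-(3 / 2) : ℝ) * t⁻¹ * z⁻¹) := by ring
    _ ≤ (1 * 2 / 4) * (t ^ (-(3 / 2) : ℝ) * t⁻¹ * z⁻¹) := by gcongr
    _ = _ := by norm_num [Nat.factorial]; ring

/-! ### Interpolated kernel bounds and integrals against them. -/

/-- Interpolation between a uniform bound and a bound by the inverse distance. -/
theorem le_rpow_mul_rpow {x u v θ : ℝ} (hx : 0 ≤ x) (hu : x ≤ u) (hv : x ≤ v) (h0 : 0 ≤ θ)
    (h1 : θ ≤ 1) : x ≤ u ^ (1 - θ) * v ^ θ := by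
  rcases hx.eq_or_lt with rfl | hx
  · exact mul_nonneg (Real.rpow_nonneg hu _) (Real.rpow_nonneg hv _)
  calc x = x ^ (1 - θ) * x ^ θ := by rw [← Real.rpow_add hx]; simp
    _ ≤ _ := mul_le_mul (Real.rpow_le_rpow hx.le hu (by linarith)) (Real.rpow_le_rpow hx.le hv h0)
      (by positivity) (Real.rpow_nonneg (hx.le.trans hu) _)

theorem norm_fresnelKernel_zero_le_rpow {t z θ : ℝ} (ht : 0 < t) (hz : 0 < z) (h0 : 0 ≤ θ)
    (h1 : θ ≤ 1) : ‖fresnelKernel t 0 z‖ ≤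
      (√Real.pi / 2) ^ (1 - θ) * (1 / √2) ^ θ * t ^ (-(1 / 2) - θ / 2) * z ^ (-θ) := by
  refine (le_rpow_mul_rpow (norm_nonneg _) (norm_fresnelKernel_zero_le ht hz.le)
    (norm_fresnelKernel_zero_le_div ht hz) h0 h1).trans_eq ?_
  rw [Real.mul_rpow (by positivity) (by positivity), Real.mul_rpow (by positivity) (by positivity),
    Real.mul_rpow (by positivity) (by positivity), ← Real.rpow_mul ht.le, ← Real.rpow_mul ht.le,
    ← Real.rpow_neg_one z, ← Real.rpow_mul hz.le,
    show (-(1 / 2) - θ / 2 : ℝ) = -(1 / 2) * (1 - θ) + -1 * θ by ring, Real.rpow_add ht,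
    show -1 * θ = -θ by ring]
  ring

theorem norm_fresnelKernel_three_le_rpow {t z θ : ℝ} (ht : 0 < t) (hz : 0 < z) (h0 : 0 ≤ θ)
    (h1 : θ ≤ 1) : ‖fresnelKernel t 3 z‖ ≤ 1 / 12 * t ^ (-2 - θ / 2) * z ^ (-θ) := by
  refine (le_rpow_mul_rpow (norm_nonneg _) (norm_fresnelKernel_three_le ht hz.le)
    (norm_fresnelKernel_three_le_div ht hz) h0 h1).trans_eq ?_
  have h12 : (1 / 12 : ℝ) = (1 / 12) ^ (1 - θ) * (1 / 12) ^ θ := by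
    rw [← Real.rpow_add (by norm_num)]; simp
  rw [Real.mul_rpow (by positivity) (by positivity), Real.mul_rpow (by positivity) (by positivity),
    Real.mul_rpow (by positivity) (by positivity), ← Real.rpow_mul ht.le, ← Real.rpow_mul ht.le,
    ← Real.rpow_neg_one z, ← Real.rpow_mul hz.le,
    show (-2 - θ / 2 : ℝ) = -2 * (1 - θ) + -(5 / 2) * θ by ring, Real.rpow_add ht,
    show -1 * θ = -θ by ring]
  nth_rewrite 3 [h12]
  ring

/-- As c ≥ 0, z^(-θ) ≤ (z-c)^(-θ): the worst interval starts at 0, and only the length L enters. -/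
theorem norm_integral_mul_le_rpow {c L θ A C : ℝ} (hc : 0 ≤ c) (hL : 0 ≤ L) (h0 : 0 ≤ θ)
    (h1 : θ < 1) {g ψ : ℝ → ℂ} (hA : 0 ≤ A) (hg : ∀ z, ‖g z‖ ≤ A) (hC : 0 ≤ C)
    (hψ : ∀ z, 0 < z → ‖ψ z‖ ≤ C * z ^ (-θ)) :
    ‖∫ z in c..c + L, g z * ψ z‖ ≤ A * C * (L ^ (1 - θ) / (1 - θ)) := by
  have hi : IntervalIntegrable (fun z => A * C * (z - c) ^ (-θ)) volume c (c + L) := by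
    have := (intervalIntegral.intervalIntegrable_rpow' (a := 0) (b := L) (r := -θ)
      (by linarith)).comp_sub_right c
    rw [zero_add, add_comm L c] at this
    exact this.const_mul _
  refine (intervalIntegral.norm_integral_le_of_norm_le (by linarith) ?_ hi).trans_eq ?_
  · filter_upwards with z hz
    rw [norm_mul, mul_assoc]
    have hz0 : 0 < z - c := sub_pos.2 hz.1
    have : z ^ (-θ) ≤ (z - c) ^ (-θ) :=
      Real.rpow_le_rpow_of_nonpos hz0 (by linarith) (by linarith)
    gcongr
    · exact hg z
    · exact (hψ z (by linarith)).trans (by gcongr)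
  · rw [intervalIntegral.integral_const_mul,
      intervalIntegral.integral_comp_sub_right (fun z => z ^ (-θ)), integral_rpow (by left; linarith)]
    rw [sub_self, add_sub_cancel_left, Real.zero_rpow (by linarith), sub_zero,
      show -θ + 1 = 1 - θ by ring]

theorem norm_integral_mul_le_rpow_of_support {c L θ A C : ℝ} (hc : 0 ≤ c) (hL : 0 ≤ L) (h0 : 0 ≤ θ)
    (h1 : θ < 1) {g ψ : ℝ → ℂ} (hA : 0 ≤ A) (hg : ∀ z, ‖g z‖ ≤ A) (hC : 0 ≤ C)
    (hψ : ∀ z, 0 < z → ‖ψ z‖ ≤ C * z ^ (-θ)) (hs : Function.support g ⊆ Icc c (c + L)) :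
    ‖∫ z, g z * ψ z‖ ≤ A * C * (L ^ (1 - θ) / (1 - θ)) := by
  rw [← setIntegral_eq_integral_of_forall_compl_eq_zero (s := Icc c (c + L)),
    integral_Icc_eq_integral_Ioc, ← intervalIntegral.integral_of_le (by linarith)]
  · exact norm_integral_mul_le_rpow hc hL h0 h1 hA hg hC hψ
  · intro x hx
    have : g x = 0 := by
      by_contra h
      exact hx (hs h)
    rw [this, zero_mul]

/-! ### Non-stationary decay by four integrations by parts. -/

theorem contDiff_iteratedDeriv_one {n m : ℕ} {g : ℝ → ℂ} (hg : ContDiff ℝ n g) (h : m < n) :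
    ContDiff ℝ 1 (iteratedDeriv m g) := by
  rw [iteratedDeriv_eq_iterate]
  refine ContDiff.iterate_deriv' 1 m (hg.of_le ?_)
  exact_mod_cast (by omega : 1 + m ≤ n)

theorem hasCompactSupport_iteratedDeriv {g : ℝ → ℂ} (hg : HasCompactSupport g) (n : ℕ) :
    HasCompactSupport (iteratedDeriv n g) := by
  induction n with
  | zero => simpa using hg
  | succ n ih => rw [iteratedDeriv_succ]; exact ih.deriv

theorem tsupport_iteratedDeriv_subset (g : ℝ → ℂ) (n : ℕ) :
    tsupport (iteratedDeriv n g) ⊆ tsupport g := by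
  induction n with
  | zero => simp
  | succ n ih => rw [iteratedDeriv_succ]; exact (tsupport_deriv_subset).trans ih

theorem integral_mul_antideriv {g ψ φ : ℝ → ℂ} (hg : ContDiff ℝ 1 g) (hs : HasCompactSupport g)
    (hψ : ∀ z, HasDerivAt ψ (-φ z) z) (hφ : Continuous φ) :
    ∫ z, g z * φ z = ∫ z, deriv g z * ψ z := by
  have hψc : Continuous ψ := continuous_iff_continuousAt.2 fun z => (hψ z).continuousAt
  have hg' : Continuous (deriv g) := hg.continuous_deriv le_rfl
  have := integral_mul_deriv_eq_deriv_mul_of_integrable (u := g) (v := ψ) (u' := deriv g)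
    (v' := fun z => -φ z) (fun z _ => (hg.differentiable one_ne_zero z).hasDerivAt) (fun z _ => hψ z)
    ((hg.continuous.mul hφ.neg).integrable_of_hasCompactSupport hs.mul_right)
    ((hg'.mul hψc).integrable_of_hasCompactSupport hs.deriv.mul_right)
    ((hg.continuous.mul hψc).integrable_of_hasCompactSupport hs.mul_right)
  simp only [mul_neg, integral_neg] at this
  exact neg_injective this

theorem integral_mul_cexp_sq_eq {t : ℝ} (ht : 0 < t) {g : ℝ → ℂ} (hg : ContDiff ℝ 4 g)
    (hs : HasCompactSupport g) :
    ∫ z, g z * Complex.exp (-Complex.I * t * z ^ 2) =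
      ∫ z, iteratedDeriv 4 g z * fresnelKernel t 3 z := by
  have hc : ∀ m, m < 4 → ContDiff ℝ 1 (iteratedDeriv m g) := fun m hm =>
    contDiff_iteratedDeriv_one hg hm
  have hk := hasCompactSupport_iteratedDeriv hs
  have step : ∀ m, m < 3 → ∫ z, iteratedDeriv (m + 1) g z * fresnelKernel t m z =
      ∫ z, iteratedDeriv (m + 2) g z * fresnelKernel t (m + 1) z := fun m hm => by
    rw [iteratedDeriv_succ (n := m + 1)]
    exact integral_mul_antideriv (hc _ (by omega)) (hk _)
      (hasDerivAt_fresnelKernel_succ ht m) (continuous_fresnelKernel ht m)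
  rw [← step 2 (by norm_num), ← step 1 (by norm_num), ← step 0 (by norm_num), zero_add,
    iteratedDeriv_succ]
  have := integral_mul_antideriv (hc 0 (by omega)) (hk 0) (hasDerivAt_fresnelKernel_zero ht)
    (by fun_prop)
  rwa [iteratedDeriv_zero] at this ⊢

/-- Non-stationary oscillatory integrals decay: the amplitude is supported in a bounded interval
of the positive half-line and only its fourth derivative is needed. -/
theorem norm_integral_mul_cexp_sq_le {t c L δ A : ℝ} (ht : 0 < t) (hc : 0 ≤ c) (hL : 0 ≤ L)
    (h0 : 2 ≤ δ) (h1 : δ < 5 / 2) {g : ℝ → ℂ} (hg : ContDiff ℝ 4 g)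
    (hs : tsupport g ⊆ Icc c (c + L)) (hA : 0 ≤ A) (hgA : ∀ z, ‖iteratedDeriv 4 g z‖ ≤ A) :
    ‖∫ z, g z * Complex.exp (-Complex.I * t * z ^ 2)‖ ≤
      A / 12 * t ^ (-δ) * (L ^ (5 - 2 * δ) / (5 - 2 * δ)) := by
  have hk : HasCompactSupport g := isCompact_Icc.of_isClosed_subset (isClosed_tsupport g) hs
  rw [integral_mul_cexp_sq_eq ht hg hk]
  -- θ = 2δ-4 turns the time exponent -2-θ/2 into -δ, and θ < 1 is the condition δ < 5/2.
  refine (norm_integral_mul_le_rpow_of_support (θ := 2 * δ - 4) (C := 1 / 12 * t ^ (-δ)) hc hL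
    (by linarith) (by linarith) hA hgA (by positivity) (fun z hz => ?_)
    ((subset_tsupport _).trans ((tsupport_iteratedDeriv_subset g 4).trans hs))).trans_eq ?_
  · have := norm_fresnelKernel_three_le_rpow ht hz (θ := 2 * δ - 4) (by linarith) (by linarith)
    rwa [show (-2 - (2 * δ - 4) / 2 : ℝ) = -δ by ring] at this
  · rw [show (1 - (2 * δ - 4) : ℝ) = 5 - 2 * δ by ring]
    ring

theorem norm_integral_mul_cexp_sq_le_of_neg {t c L δ A : ℝ} (ht : 0 < t) (hc : 0 ≤ c) (hL : 0 ≤ L)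
    (h0 : 2 ≤ δ) (h1 : δ < 5 / 2) {g : ℝ → ℂ} (hg : ContDiff ℝ 4 g)
    (hs : tsupport g ⊆ Icc (-(c + L)) (-c)) (hA : 0 ≤ A) (hgA : ∀ z, ‖iteratedDeriv 4 g z‖ ≤ A) :
    ‖∫ z, g z * Complex.exp (-Complex.I * t * z ^ 2)‖ ≤
      A / 12 * t ^ (-δ) * (L ^ (5 - 2 * δ) / (5 - 2 * δ)) := by
  have h := norm_integral_mul_cexp_sq_le ht hc hL h0 h1 (g := fun z => g (-z))
    (hg.comp contDiff_neg) ?_ hA fun z => ?_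
  · rw [← integral_neg_eq_self]
    simpa using h
  · refine closure_minimal (fun z hz => ?_) isClosed_Icc
    have := hs (subset_tsupport g (show g (-z) ≠ 0 from hz))
    constructor <;> linarith [this.1, this.2]
  · rw [iteratedDeriv_comp_neg]
    simpa using hgA (-z)

/-- Leibniz rule; the binomial coefficients sum to 2^n. -/
theorem norm_iteratedDeriv_mul_le {n : ℕ} {f g : ℝ → ℂ} {F G : ℝ} (hf : ContDiff ℝ n f)
    (hg : ContDiff ℝ n g) (hF : 0 ≤ F) (hbf : ∀ j ≤ n, ∀ x, ‖iteratedDeriv j f x‖ ≤ F)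
    (hbg : ∀ j ≤ n, ∀ x, ‖iteratedDeriv j g x‖ ≤ G) (x : ℝ) :
    ‖iteratedDeriv n (fun x => f x * g x) x‖ ≤ 2 ^ n * (F * G) := by
  rw [← norm_iteratedFDeriv_eq_norm_iteratedDeriv]
  refine (norm_iteratedFDeriv_mul_le hf hg x le_rfl).trans ?_
  have hsum : ((2 : ℝ) ^ n) = ∑ i ∈ Finset.range (n + 1), (n.choose i : ℝ) := by
    exact_mod_cast (Nat.sum_range_choose n).symm
  rw [hsum, Finset.sum_mul]
  refine Finset.sum_le_sum fun i hi => ?_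
  rw [norm_iteratedFDeriv_eq_norm_iteratedDeriv, norm_iteratedFDeriv_eq_norm_iteratedDeriv,
    mul_assoc]
  gcongr
  · exact hbf i (by simpa [Nat.lt_succ_iff] using hi) x
  · exact hbg _ (Nat.sub_le _ _) x

/-- Decay of the oscillatory convolution integrals when the second factor is supported away
from the origin. -/
theorem norm_integral_conv_cexp_le {a b p₁ p₂ p t δ F G : ℝ} (ht : 0 < t) (hab : a ≤ b)
    (hz : (0 : ℝ) ∉ Icc p₁ p₂) (h0 : 2 ≤ δ) (h1 : δ < 5 / 2) {v u : ℝ → ℂ}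
    (hv : ContDiff ℝ 4 v) (hu : ContDiff ℝ 4 u) (hvs : tsupport v ⊆ Icc a b)
    (hus : tsupport u ⊆ Icc p₁ p₂) (hF : 0 ≤ F) (hG : 0 ≤ G)
    (hbv : ∀ j ≤ 4, ∀ x, ‖iteratedDeriv j v x‖ ≤ F)
    (hbu : ∀ j ≤ 4, ∀ x, ‖iteratedDeriv j u x‖ ≤ G) :
    ‖∫ y in a..b, v y * u (p - y) * Complex.exp (-Complex.I * t * (p - y) ^ 2)‖ ≤
      2 * (F * G) * t ^ (-δ) * ((b - a) ^ (5 - 2 * δ) / (5 - 2 * δ)) := by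
  have hv0 : ∀ x, x ∉ Icc a b → v x = 0 := fun x hx => by
    by_contra h
    exact hx (hvs (subset_tsupport v h))
  have hu0 : ∀ x, x ∉ Icc p₁ p₂ → u x = 0 := fun x hx => by
    by_contra h
    exact hx (hus (subset_tsupport u h))
  have e1 : ∫ y in a..b, v y * u (p - y) * Complex.exp (-Complex.I * t * (p - y) ^ 2) =
      ∫ z, (v (p - z) * u z) * Complex.exp (-Complex.I * t * z ^ 2) := by
    rw [← integral_sub_left_eq_self _ volume p, intervalIntegral.integral_of_le hab,
      ← integral_Icc_eq_integral_Ioc, setIntegral_eq_integral_of_forall_compl_eq_zero]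
    · simp
    · intro y hy
      rw [hv0 y hy, zero_mul, zero_mul]
  rw [e1]
  have hg : ContDiff ℝ 4 fun z => v (p - z) * u z :=
    (hv.comp (contDiff_const.sub contDiff_id)).mul hu
  have hgA : ∀ z, ‖iteratedDeriv 4 (fun z => v (p - z) * u z) z‖ ≤ 2 ^ 4 * (F * G) := by
    refine norm_iteratedDeriv_mul_le (hv.comp (contDiff_const.sub contDiff_id)) hu hF
      (fun j hj x => ?_) hbu
    have : iteratedDeriv j (fun z => v (p - z)) = fun z => (-1 : ℝ) ^ j • iteratedDeriv j v (p - z) :=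
      iteratedDeriv_comp_const_sub j v p
    rw [this]
    simpa [norm_smul] using hbv j hj (p - x)
  have hA : 0 ≤ 2 ^ 4 * (F * G) := by positivity
  have hr : 0 ≤ t ^ (-δ) * ((b - a) ^ (5 - 2 * δ) / (5 - 2 * δ)) :=
    mul_nonneg (by positivity) (div_nonneg (Real.rpow_nonneg (by linarith) _) (by linarith))
  -- The Leibniz constant 2^4 over the kernel constant 12 is 4/3, rounded up to 2.
  have fin : 2 ^ 4 * (F * G) / 12 * t ^ (-δ) * ((b - a) ^ (5 - 2 * δ) / (5 - 2 * δ)) ≤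
      2 * (F * G) * t ^ (-δ) * ((b - a) ^ (5 - 2 * δ) / (5 - 2 * δ)) := by
    have : 0 ≤ F * G := by positivity
    nlinarith [mul_nonneg this hr]
  refine le_trans ?_ fin
  have hsupp : ∀ z, v (p - z) * u z ≠ 0 → z ∈ Icc p₁ p₂ ∧ p - z ∈ Icc a b := fun z hz =>
    ⟨by_contra fun h => hz (by rw [hu0 z h, mul_zero]),
      by_contra fun h => hz (by rw [hv0 _ h, zero_mul])⟩
  -- [p₁,p₂] lies on one side of 0. The amplitude lives in its intersection with [p-b, p-a], so an
  -- interval of length b-a on that side, starting at the larger left endpoint (after reflection in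
  -- the negative case), contains the support.
  rcases lt_or_ge 0 p₁ with hpos | hneg
  · refine norm_integral_mul_cexp_sq_le (c := max p₁ (p - b)) ht (hpos.le.trans (le_max_left _ _))
      (by linarith) h0 h1 hg (closure_minimal (fun z hz => ?_) isClosed_Icc) hA hgA
    obtain ⟨hz1, hz2⟩ := hsupp z hz
    exact ⟨max_le hz1.1 (by linarith [hz2.2]), by linarith [hz2.1, le_max_right p₁ (p - b)]⟩
  · have hp2 : p₂ < 0 := by
      by_contra h
      exact hz ⟨hneg, not_lt.1 h⟩
    refine norm_integral_mul_cexp_sq_le_of_neg (c := max (-p₂) (a - p)) ht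
      (le_max_of_le_left (by linarith)) (by linarith) h0 h1 hg
      (closure_minimal (fun z hz => ?_) isClosed_Icc) hA hgA
    obtain ⟨hz1, hz2⟩ := hsupp z hz
    exact ⟨by linarith [hz2.2, le_max_right (-p₂) (a - p)],
      le_neg.2 (max_le (by linarith [hz1.2]) (by linarith [hz2.1]))⟩

/-! ### Stationary phase with uniform remainder. -/

theorem norm_setIntegral_Ioi_mul_cexp_sq_sub_le {t α L θ D : ℝ} (ht : 0 < t) (hL : 0 ≤ L)
    (h0 : 0 ≤ θ) (h1 : θ < 1) {f : ℝ → ℂ} (hf : ContDiff ℝ 1 f)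
    (hs : tsupport f ⊆ Icc α (α + L)) (hD : ∀ z, ‖deriv f z‖ ≤ D) :
    ‖(∫ z in Ioi (0 : ℝ), f z * Complex.exp (-Complex.I * t * z ^ 2)) -
        f 0 * fresnelKernel t 0 0‖ ≤
      D * ((√Real.pi / 2) ^ (1 - θ) * (1 / √2) ^ θ * t ^ (-(1 / 2) - θ / 2)) *
        (L ^ (1 - θ) / (1 - θ)) := by
  have hk : HasCompactSupport f := isCompact_Icc.of_isClosed_subset (isClosed_tsupport f) hs
  have hψ := hasDerivAt_fresnelKernel_zero ht
  have hψc := continuous_fresnelKernel ht 0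
  have hf' := hf.continuous_deriv le_rfl
  have hψ1 : ContDiff ℝ 1 (fresnelKernel t 0) := by
    rw [contDiff_one_iff_deriv]
    refine ⟨fun z => (hψ z).differentiableAt, ?_⟩
    rw [funext fun z => (hψ z).deriv]
    fun_prop
  -- One integration by parts on the half-line: the boundary term at 0 is the leading term, and f'
  -- against the kernel is the remainder.
  have key := HasCompactSupport.integral_Ioi_deriv_eq (hf.mul hψ1) hk.mul_right 0
  have hd : ∀ z, deriv (fun z => f z * fresnelKernel t 0 z) z =
      deriv f z * fresnelKernel t 0 z - f z * Complex.exp (-Complex.I * t * z ^ 2) := fun z => by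
    refine (((hf.differentiable one_ne_zero z).hasDerivAt).fun_mul (hψ z)).deriv.trans ?_
    ring
  have i1 : Integrable fun z => deriv f z * fresnelKernel t 0 z :=
    (hf'.mul hψc).integrable_of_hasCompactSupport hk.deriv.mul_right
  have i2 : Integrable fun z => f z * Complex.exp (-Complex.I * t * z ^ 2) :=
    (hf.continuous.mul (by fun_prop)).integrable_of_hasCompactSupport hk.mul_right
  simp_rw [hd] at key
  rw [integral_sub i1.integrableOn i2.integrableOn] at key
  have e : (∫ z in Ioi (0 : ℝ), f z * Complex.exp (-Complex.I * t * z ^ 2)) -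
      f 0 * fresnelKernel t 0 0 = ∫ z, (Ioi (0 : ℝ)).indicator (deriv f) z * fresnelKernel t 0 z := by
    have : ∀ z, (Ioi (0 : ℝ)).indicator (deriv f) z * fresnelKernel t 0 z =
        (Ioi (0 : ℝ)).indicator (fun z => deriv f z * fresnelKernel t 0 z) z := fun z => by
      by_cases hz : z ∈ Ioi (0 : ℝ) <;> simp [hz]
    simp_rw [this]
    rw [integral_indicator measurableSet_Ioi]
    linear_combination -key
  rw [e]
  refine norm_integral_mul_le_rpow_of_support (c := max α 0) (le_max_right _ _) hL h0 h1
    ((norm_nonneg _).trans (hD 0)) (fun z => ?_) (by positivity)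
    (fun z hz => norm_fresnelKernel_zero_le_rpow ht hz h0 h1.le) fun z hz => ?_
  · exact (norm_indicator_le_norm_self _ _).trans (hD z)
  · have hz' : z ∈ Ioi (0 : ℝ) ∧ deriv f z ≠ 0 := by simpa [indicator_apply_eq_zero] using hz
    have := hs (tsupport_deriv_subset (subset_tsupport _ hz'.2))
    exact ⟨max_le this.1 (le_of_lt hz'.1), by linarith [this.2, le_max_left α 0]⟩

/-- Stationary phase with a remainder estimate that is uniform in the stationary point. -/
theorem norm_integral_mul_cexp_sq_sub_le {t q L θ D : ℝ} (ht : 0 < t) (hL : 0 ≤ L)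
    (h0 : 0 ≤ θ) (h1 : θ < 1) {w : ℝ → ℂ} (hw : ContDiff ℝ 1 w)
    (hs : tsupport w ⊆ Icc q (q + L)) (hD : ∀ z, ‖deriv w z‖ ≤ D) (p₀ : ℝ) :
    ‖(∫ p, w p * Complex.exp (-Complex.I * t * (p - p₀) ^ 2)) -
        eighthRoot⁻¹ * √(Real.pi / t) * w p₀‖ ≤
      2 * (D * ((√Real.pi / 2) ^ (1 - θ) * (1 / √2) ^ θ * t ^ (-(1 / 2) - θ / 2)) *
        (L ^ (1 - θ) / (1 - θ))) := by
  have hk : HasCompactSupport w := isCompact_Icc.of_isClosed_subset (isClosed_tsupport w) hs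
  have e0 : ∫ p, w p * Complex.exp (-Complex.I * t * (p - p₀) ^ 2) =
      ∫ z, w (p₀ + z) * Complex.exp (-Complex.I * t * z ^ 2) := by
    rw [← integral_add_left_eq_self _ p₀]
    simp
  have i2 : Integrable fun z => w (p₀ + z) * Complex.exp (-Complex.I * t * z ^ 2) := by
    refine ((hw.continuous.comp (by fun_prop)).mul
      (by fun_prop)).integrable_of_hasCompactSupport (HasCompactSupport.mul_right ?_)
    exact hk.comp_homeomorph (Homeomorph.addLeft p₀)
  -- Split at the stationary point; each half contributes half of the leading term, the kernel at 0
  -- being √(π/t)/(2ω).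
  have e1 : ∫ z, w (p₀ + z) * Complex.exp (-Complex.I * t * z ^ 2) =
      (∫ z in Ioi (0 : ℝ), w (p₀ + z) * Complex.exp (-Complex.I * t * z ^ 2)) +
      ∫ z in Ioi (0 : ℝ), w (p₀ - z) * Complex.exp (-Complex.I * t * z ^ 2) := by
    have h : ∫ z in Ioi (0 : ℝ), w (p₀ - z) * Complex.exp (-Complex.I * t * z ^ 2) =
        ∫ z in Iic (0 : ℝ), w (p₀ + z) * Complex.exp (-Complex.I * t * z ^ 2) := by
      rw [← neg_zero, ← integral_comp_neg_Ioi, neg_zero]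
      simp [sub_eq_add_neg]
    rw [h, add_comm, ← setIntegral_union (Iic_disjoint_Ioi le_rfl) measurableSet_Ioi
      i2.integrableOn i2.integrableOn, Iic_union_Ioi, setIntegral_univ]
  have hsupp : ∀ z, w z ≠ 0 → z ∈ Icc q (q + L) := fun z hz => hs (subset_tsupport w hz)
  have hp := norm_setIntegral_Ioi_mul_cexp_sq_sub_le (f := fun z => w (p₀ + z)) (α := q - p₀) (D := D)
    ht hL h0 h1 (hw.comp (contDiff_const.add contDiff_id))
    (closure_minimal (fun z hz => by
      have := hsupp _ hz
      constructor <;> linarith [this.1, this.2]) isClosed_Icc) fun z => by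
        rw [deriv_comp_const_add]; exact hD _
  have hm := norm_setIntegral_Ioi_mul_cexp_sq_sub_le (f := fun z => w (p₀ - z)) (α := p₀ - (q + L))
    (D := D) ht hL h0 h1 (hw.comp (contDiff_const.sub contDiff_id))
    (closure_minimal (fun z hz => by
      have := hsupp _ hz
      constructor <;> linarith [this.1, this.2]) isClosed_Icc) fun z => by
        rw [deriv_comp_const_sub, norm_neg]; exact hD _
  rw [e0, e1, two_mul]
  refine le_trans (le_of_eq ?_) ((norm_add_le _ _).trans (add_le_add hp hm))
  congr 1
  rw [fresnelKernel_zero_at_zero, add_zero, sub_zero]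
  push_cast
  ring

theorem sqrt_two_div_pi_le :
    √(2 / Real.pi) ≤ 1 / (2 * √Real.pi) + √(1 / (4 * Real.pi) + 1 / 2) := by
  have h1 : √(2 / Real.pi) ≤ 4 / 5 := by
    rw [Real.sqrt_le_left (by norm_num), div_le_iff₀ Real.pi_pos]
    linarith [Real.pi_gt_d2]
  have h2 : 1 / 4 ≤ 1 / (2 * √Real.pi) := by
    have : √Real.pi ≤ 2 := by
      rw [Real.sqrt_le_left (by norm_num)]
      linarith [Real.pi_le_four]
    have h : 0 < √Real.pi := Real.sqrt_pos.2 Real.pi_pos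
    rw [div_le_div_iff₀ (by norm_num) (by positivity)]
    linarith
  have h3 : 7 / 10 ≤ √(1 / (4 * Real.pi) + 1 / 2) := by
    apply Real.le_sqrt_of_sq_le
    have : 0 < 1 / (4 * Real.pi) := by positivity
    linarith
  linarith

/-- With θ = 2δ-1 the interpolated constant is √π/2 times √(2/π)^θ, and √(2/π) is below the base
used in `constK`. -/
theorem stationary_constant_le {δ L : ℝ} (h0 : 1 / 2 ≤ δ) (h1 : δ < 1) (hL : 0 ≤ L) :
    2 * ((√Real.pi / 2) ^ (1 - (2 * δ - 1)) * (1 / √2) ^ (2 * δ - 1) *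
      (L ^ (1 - (2 * δ - 1)) / (1 - (2 * δ - 1)))) ≤ 2 * Real.pi * constK δ L := by
  have hπ : 0 < √Real.pi := Real.sqrt_pos.2 Real.pi_pos
  have e : (√Real.pi / 2) ^ (1 - (2 * δ - 1)) * (1 / √2) ^ (2 * δ - 1) =
      √Real.pi / 2 * √(2 / Real.pi) ^ (2 * δ - 1) := by
    have : √(2 / Real.pi) = (√Real.pi / 2)⁻¹ * (1 / √2) := by
      rw [Real.sqrt_div (by norm_num)]
      have : √2 * √2 = 2 := Real.mul_self_sqrt (by norm_num)
      field_simp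
      linarith
    rw [this, Real.mul_rpow (by positivity) (by positivity), Real.inv_rpow (by positivity),
      Real.rpow_sub (by positivity), Real.rpow_one]
    ring
  have h2 : √(2 / Real.pi) ^ (2 * δ - 1) ≤
      (1 / (2 * √Real.pi) + √(1 / (4 * Real.pi) + 1 / 2)) ^ (2 * δ - 1) :=
    Real.rpow_le_rpow (by positivity) sqrt_two_div_pi_le (by linarith)
  rw [e, constK, show (1 - (2 * δ - 1) : ℝ) = 2 - 2 * δ by ring]
  have hd : 0 < 2 - 2 * δ := by linarith
  have hd' : (4 - 4 * δ) = 2 * (2 - 2 * δ) := by ring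
  have e2 : 2 * Real.pi * (1 / ((4 - 4 * δ) * √Real.pi) *
      (1 / (2 * √Real.pi) + √(1 / (4 * Real.pi) + 1 / 2)) ^ (2 * δ - 1) * L ^ (2 - 2 * δ)) =
      2 * (√Real.pi / 2 * (1 / (2 * √Real.pi) + √(1 / (4 * Real.pi) + 1 / 2)) ^ (2 * δ - 1) *
        (L ^ (2 - 2 * δ) / (2 - 2 * δ))) := by
    rw [hd']
    generalize (1 / (2 * √Real.pi) + √(1 / (4 * Real.pi) + 1 / 2)) ^ (2 * δ - 1) = X
    field_simp
    rw [Real.sq_sqrt Real.pi_pos.le]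
  rw [e2]
  gcongr

/-! ### Time integrals, the oscillatory convolution and regularity of the amplitude. -/

theorem hasDerivAt_intervalIntegral_of_continuous {F F' : ℝ → ℝ → ℂ}
    (hF : Continuous (Function.uncurry F)) (hF' : Continuous (Function.uncurry F'))
    (hd : ∀ x y, HasDerivAt (fun x => F x y) (F' x y) x) (a b x₀ : ℝ) :
    HasDerivAt (fun x => ∫ y in a..b, F x y) (∫ y in a..b, F' x₀ y) x₀ := by
  have hFx : ∀ x, Continuous (F x) := fun x => hF.comp (by fun_prop : Continuous fun y => (x, y))
  have hFx' : Continuous (F' x₀) := hF'.comp (by fun_prop : Continuous fun y => (x₀, y))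
  obtain ⟨C, hC⟩ := ((isCompact_closedBall x₀ 1).prod isCompact_uIcc).exists_bound_of_continuousOn
    (s := Metric.closedBall x₀ 1 ×ˢ uIcc a b) hF'.continuousOn
  refine (intervalIntegral.hasDerivAt_integral_of_dominated_loc_of_deriv_le
    (bound := fun _ => C) (Metric.ball_mem_nhds x₀ one_pos)
    (Eventually.of_forall fun x => (hFx x).aestronglyMeasurable)
    ((hFx x₀).intervalIntegrable a b) hFx'.aestronglyMeasurable ?_
    intervalIntegrable_const ?_).2
  · exact Eventually.of_forall fun y hy x hx =>
      hC (x, y) ⟨Metric.ball_subset_closedBall hx, uIoc_subset_uIcc hy⟩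
  · exact Eventually.of_forall fun y _ x _ => hd x y

/-- Split at τ = 1; the tail is bounded by the integral of τ^(-δ) over (1,∞), which is 1/(δ-1). -/
theorem norm_intervalIntegral_le_of_decay {f : ℝ → ℂ} (hf : Continuous f) {c₀ c₁ δ t : ℝ}
    (hc₀ : 0 ≤ c₀) (hc₁ : 0 ≤ c₁) (hδ : 1 < δ) (ht : 0 ≤ t)
    (h₀ : ∀ τ, 0 ≤ τ → τ ≤ 1 → ‖f τ‖ ≤ c₀) (h₁ : ∀ τ, 1 ≤ τ → ‖f τ‖ ≤ c₁ * τ ^ (-δ)) :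
    ‖∫ τ in (0 : ℝ)..t, f τ‖ ≤ c₀ + c₁ * (1 / (δ - 1)) := by
  have hd : 0 ≤ c₁ * (1 / (δ - 1)) := mul_nonneg hc₁ (by have : 0 < δ - 1 := by linarith
                                                         positivity)
  have short : ∀ s, 0 ≤ s → s ≤ 1 → ‖∫ τ in (0 : ℝ)..s, f τ‖ ≤ c₀ := fun s hs hs1 => by
    have := intervalIntegral.norm_integral_le_of_norm_le_const (a := 0) (b := s) (C := c₀) (f := f)
      fun x hx => by
        rw [uIoc_of_le hs] at hx
        exact h₀ x hx.1.le (hx.2.trans hs1)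
    rw [sub_zero, abs_of_nonneg hs] at this
    nlinarith
  rcases le_total t 1 with h | h
  · linarith [short t ht h]
  · rw [← intervalIntegral.integral_add_adjacent_intervals (hf.intervalIntegrable 0 1)
      (hf.intervalIntegrable 1 t)]
    have h0 : (0 : ℝ) ∉ uIcc 1 t := by
      rw [uIcc_of_le h]
      exact fun hx => by linarith [hx.1]
    have hi : IntervalIntegrable (fun τ => c₁ * τ ^ (-δ)) volume 1 t :=
      (intervalIntegral.intervalIntegrable_rpow (Or.inr h0)).const_mul _
    have h2 := intervalIntegral.norm_integral_le_of_norm_le h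
      (Eventually.of_forall fun τ (hτ : τ ∈ Ioc 1 t) => h₁ τ hτ.1.le) hi
    rw [intervalIntegral.integral_const_mul, integral_rpow (Or.inr ⟨by linarith, h0⟩),
      Real.one_rpow] at h2
    refine (norm_add_le _ _).trans (add_le_add (short 1 zero_le_one le_rfl) (h2.trans ?_))
    refine mul_le_mul_of_nonneg_left ?_ hc₁
    rw [show (t ^ (-δ + 1) - 1) / (-δ + 1) = (1 - t ^ (-δ + 1)) / (δ - 1) by
      rw [← neg_div_neg_eq]; ring_nf]
    have : 0 < δ - 1 := by linarith
    have : 0 ≤ t ^ (-δ + 1) := by positivity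
    gcongr
    linarith

/-- The oscillatory convolution `∫ₐᵇ v(y) u(p - y) exp(i τ (2 p y - y²)) dy`. -/
noncomputable def oscConv (v u : ℝ → ℂ) (a b τ p : ℝ) : ℂ :=
  ∫ y in a..b, v y * u (p - y) * Complex.exp (Complex.I * τ * (2 * p * y - y ^ 2))

theorem integral_mul_cexp_eq_oscConv (v u : ℝ → ℂ) (a b τ p : ℝ) :
    (∫ y in a..b, v y * u (p - y) * Complex.exp (-Complex.I * τ * (p - y) ^ 2)) *
      Complex.exp (Complex.I * τ * p ^ 2) = oscConv v u a b τ p := by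
  rw [oscConv, ← intervalIntegral.integral_mul_const]
  congr 1 with y
  rw [mul_assoc, ← Complex.exp_add]
  ring_nf

theorem norm_oscConv (v u : ℝ → ℂ) (a b τ p : ℝ) : ‖oscConv v u a b τ p‖ =
    ‖∫ y in a..b, v y * u (p - y) * Complex.exp (-Complex.I * τ * (p - y) ^ 2)‖ := by
  rw [← integral_mul_cexp_eq_oscConv, norm_mul,
    show Complex.I * τ * p ^ 2 = ((τ * p ^ 2 : ℝ) : ℂ) * Complex.I by push_cast; ring,
    Complex.norm_exp_ofReal_mul_I, mul_one]

theorem amplitudeW_eq (v u : ℝ → ℂ) (a b t p : ℝ) : amplitudeW v u a b t p =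
    -(Complex.I / (2 * Real.pi)) * ∫ τ in (0 : ℝ)..t, oscConv v u a b τ p := by
  simp_rw [amplitudeW, integral_mul_cexp_eq_oscConv]

theorem continuous_oscConv {v u : ℝ → ℂ} (hv : Continuous v) (hu : Continuous u) (a b : ℝ) :
    Continuous fun x : ℝ × ℝ => oscConv v u a b x.1 x.2 := by
  unfold oscConv
  apply intervalIntegral.continuous_parametric_intervalIntegral_of_continuous'
  fun_prop

theorem continuous_oscConv_left {v u : ℝ → ℂ} (hv : Continuous v) (hu : Continuous u) (a b p : ℝ) :
    Continuous fun τ => oscConv v u a b τ p := by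
  have hs : Continuous fun τ : ℝ => (τ, p) := by fun_prop
  have h := (continuous_oscConv hv hu a b).comp hs
  exact h

/-- The factor exp(iτp²) cancels the quadratic part of the phase in p, so differentiation brings
down only 2iτy: one power of τ, and a y that is absorbed into v. -/
theorem hasDerivAt_oscConv {v u : ℝ → ℂ} (hv : Continuous v) (hu : ContDiff ℝ 1 u) (a b τ p : ℝ) :
    HasDerivAt (oscConv v u a b τ) (oscConv v (deriv u) a b τ p +
      2 * Complex.I * τ * oscConv (fun y => y * v y) u a b τ p) p := by
  have hu' := hu.continuous_deriv le_rfl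
  have huc := hu.continuous
  have h := hasDerivAt_intervalIntegral_of_continuous
    (F := fun p y => v y * u (p - y) * Complex.exp (Complex.I * τ * (2 * p * y - y ^ 2)))
    (F' := fun p y => v y * deriv u (p - y) * Complex.exp (Complex.I * τ * (2 * p * y - y ^ 2)) +
      2 * Complex.I * τ * ((y * v y) * u (p - y) *
        Complex.exp (Complex.I * τ * (2 * p * y - y ^ 2))))
    (by unfold Function.uncurry; fun_prop) (by unfold Function.uncurry; fun_prop) ?_ a b p
  · rw [intervalIntegral.integral_add (Continuous.intervalIntegrable (by fun_prop) _ _)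
      (Continuous.intervalIntegrable (by fun_prop) _ _),
      intervalIntegral.integral_const_mul] at h
    exact h
  · intro x y
    have h1 : HasDerivAt (fun x => u (x - y)) (deriv u (x - y)) x :=
      ((hu.differentiable one_ne_zero (x - y)).hasDerivAt).comp_sub_const x y
    have h2 : HasDerivAt (fun x : ℝ => Complex.I * τ * (2 * x * y - (y : ℂ) ^ 2))
        (Complex.I * τ * (2 * 1 * y)) x :=
      ((((Complex.ofRealCLM.hasDerivAt (x := x)).const_mul (2 : ℂ)).mul_const (y : ℂ)).sub_const
        ((y : ℂ) ^ 2)).const_mul (Complex.I * τ)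
    convert! (h1.const_mul (v y)).mul h2.cexp using 1
    ring

theorem continuous_deriv_oscConv {v u : ℝ → ℂ} (hv : Continuous v) (hu : ContDiff ℝ 1 u)
    (a b : ℝ) : Continuous fun x : ℝ × ℝ => oscConv v (deriv u) a b x.2 x.1 +
      2 * Complex.I * x.2 * oscConv (fun y => y * v y) u a b x.2 x.1 := by
  have hu' := hu.continuous_deriv le_rfl
  have hv' : Continuous fun y : ℝ => (y : ℂ) * v y := by fun_prop
  have hs : Continuous fun x : ℝ × ℝ => (x.2, x.1) := by fun_prop
  have h1 := (continuous_oscConv hv hu' a b).comp hs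
  have h2 := (continuous_oscConv hv' hu.continuous a b).comp hs
  have h3 : Continuous fun x : ℝ × ℝ => 2 * Complex.I * (x.2 : ℂ) := by fun_prop
  exact h1.add (h3.mul h2)

theorem hasDerivAt_amplitudeW {v u : ℝ → ℂ} (hv : Continuous v) (hu : ContDiff ℝ 1 u)
    (a b t p : ℝ) : HasDerivAt (amplitudeW v u a b t)
      (-(Complex.I / (2 * Real.pi)) * ∫ τ in (0 : ℝ)..t, (oscConv v (deriv u) a b τ p +
        2 * Complex.I * τ * oscConv (fun y => y * v y) u a b τ p)) p := by
  have hs : Continuous fun x : ℝ × ℝ => (x.2, x.1) := by fun_prop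
  rw [funext (amplitudeW_eq v u a b t)]
  exact HasDerivAt.const_mul _ (hasDerivAt_intervalIntegral_of_continuous
    (F := fun p τ => oscConv v u a b τ p)
    (F' := fun p τ => oscConv v (deriv u) a b τ p +
      2 * Complex.I * τ * oscConv (fun y => y * v y) u a b τ p)
    ((continuous_oscConv hv hu.continuous a b).comp hs) (continuous_deriv_oscConv hv hu a b)
    (fun x y => hasDerivAt_oscConv hv hu a b y x) 0 t p)

theorem contDiff_amplitudeW {v u : ℝ → ℂ} (hv : Continuous v) (hu : ContDiff ℝ 1 u) (a b t : ℝ) :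
    ContDiff ℝ 1 (amplitudeW v u a b t) := by
  rw [contDiff_one_iff_deriv]
  refine ⟨fun p => (hasDerivAt_amplitudeW hv hu a b t p).differentiableAt, ?_⟩
  rw [funext fun p => (hasDerivAt_amplitudeW hv hu a b t p).deriv]
  exact continuous_const.mul
    (intervalIntegral.continuous_parametric_intervalIntegral_of_continuous'
      (continuous_deriv_oscConv hv hu a b) _ _)

theorem tsupport_amplitudeW_subset {v u : ℝ → ℂ} {a b p₁ p₂ : ℝ} (hvs : tsupport v ⊆ Icc a b)
    (hus : tsupport u ⊆ Icc p₁ p₂) (t : ℝ) :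
    tsupport (amplitudeW v u a b t) ⊆ Icc (p₁ + a) (p₂ + b) := by
  refine closure_minimal (fun p hp => ?_) isClosed_Icc
  by_contra hn
  refine hp ?_
  have : ∀ y, v y * u (p - y) = 0 := fun y => by
    by_contra h
    have h1 := hvs (subset_tsupport v (left_ne_zero_of_mul h))
    have h2 := hus (subset_tsupport u (right_ne_zero_of_mul h))
    exact hn ⟨by linarith [h1.1, h2.1], by linarith [h1.2, h2.2]⟩
  simp [amplitudeW, this]

/-- At j = 0 the truncated index j-1 is 0, harmless because its coefficient vanishes. -/
theorem iteratedDeriv_id_mul {n : ℕ} {v : ℝ → ℂ} (hv : ContDiff ℝ n v) :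
    ∀ j ≤ n, iteratedDeriv j (fun y : ℝ => (y : ℂ) * v y) =
      fun y => y * iteratedDeriv j v y + j * iteratedDeriv (j - 1) v y := by
  intro j
  induction j with
  | zero => simp
  | succ j ih =>
    intro hj
    rw [iteratedDeriv_succ, ih (by omega)]
    ext y
    have hd : ∀ k, k < n → HasDerivAt (iteratedDeriv k v) (iteratedDeriv (k + 1) v y) y :=
      fun k hk => by
        rw [iteratedDeriv_succ]
        exact (hv.differentiable_iteratedDeriv k (by exact_mod_cast hk) y).hasDerivAt
    have h1 := (Complex.ofRealCLM.hasDerivAt (x := y)).fun_mul (hd j (by omega))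
    have h2 : HasDerivAt (fun y => (j : ℂ) * iteratedDeriv (j - 1) v y)
        (j * iteratedDeriv j v y) y := by
      rcases j with _ | j
      · simpa using hasDerivAt_const y (0 : ℂ)
      · exact (hd j (by omega)).const_mul _
    refine (h1.fun_add h2).deriv.trans ?_
    simp
    ring

theorem norm_iteratedDeriv_id_mul_le {n : ℕ} {v : ℝ → ℂ} {a b F : ℝ} (hv : ContDiff ℝ n v)
    (hvs : tsupport v ⊆ Icc a b) (hF : 0 ≤ F) (hb : ∀ j ≤ n, ∀ x, ‖iteratedDeriv j v x‖ ≤ F) :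
    ∀ j ≤ n, ∀ x, ‖iteratedDeriv j (fun y : ℝ => (y : ℂ) * v y) x‖ ≤ (max |a| |b| + n) * F := by
  intro j hj x
  rw [iteratedDeriv_id_mul hv j hj]
  have hm : 0 ≤ max |a| |b| := le_max_of_le_left (abs_nonneg a)
  have h1 : ‖(x : ℂ) * iteratedDeriv j v x‖ ≤ max |a| |b| * F := by
    by_cases hx : x ∈ Icc a b
    · rw [norm_mul, Complex.norm_real, Real.norm_eq_abs]
      exact mul_le_mul (abs_le_max_abs_abs hx.1 hx.2) (hb j hj x) (norm_nonneg _) hm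
    · have : iteratedDeriv j v x = 0 := by
        by_contra h
        exact hx (hvs (tsupport_iteratedDeriv_subset v j (subset_tsupport _ h)))
      rw [this, mul_zero, norm_zero]
      positivity
  have h2 : ‖(j : ℂ) * iteratedDeriv (j - 1) v x‖ ≤ n * F := by
    rw [norm_mul, Complex.norm_natCast]
    exact mul_le_mul (by exact_mod_cast hj) (hb _ (by omega) x) (norm_nonneg _) (by positivity)
  calc _ ≤ _ := norm_add_le _ _
    _ ≤ _ := add_le_add h1 h2
    _ = _ := by ring

theorem norm_oscConv_le {v u : ℝ → ℂ} {a b F G : ℝ} (hab : a ≤ b) (hF : 0 ≤ F)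
    (hv : ∀ x ∈ Icc a b, ‖v x‖ ≤ F) (hu : ∀ x, ‖u x‖ ≤ G) (τ p : ℝ) :
    ‖oscConv v u a b τ p‖ ≤ F * G * (b - a) := by
  have := intervalIntegral.norm_integral_le_of_norm_le_const (a := a) (b := b) (C := F * G)
    (f := fun y => v y * u (p - y) * Complex.exp (Complex.I * τ * (2 * p * y - y ^ 2)))
    fun y hy => by
      rw [uIoc_of_le hab] at hy
      rw [norm_mul, show Complex.I * τ * (2 * p * y - (y : ℂ) ^ 2) =
        ((τ * (2 * p * y - y ^ 2) : ℝ) : ℂ) * Complex.I by push_cast; ring,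
        Complex.norm_exp_ofReal_mul_I, mul_one, norm_mul]
      exact mul_le_mul (hv y (Ioc_subset_Icc_self hy)) (hu _) (norm_nonneg _) hF
  rwa [abs_of_nonneg (by linarith)] at this

/-! ### Bounds on the amplitude and its derivative, uniform in time. -/

section Bounds

variable {v u : ℝ → ℂ} {a b p₁ p₂ F G δ : ℝ}

theorem norm_integral_oscConv_le (hab : a ≤ b) (hz : (0 : ℝ) ∉ Icc p₁ p₂) (h0 : 2 < δ)
    (h1 : δ < 5 / 2) (hv : ContDiff ℝ 4 v) (hu : ContDiff ℝ 4 u) (hvs : tsupport v ⊆ Icc a b)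
    (hus : tsupport u ⊆ Icc p₁ p₂) (hF : 0 ≤ F) (hG : 0 ≤ G)
    (hbv : ∀ j ≤ 4, ∀ x, ‖iteratedDeriv j v x‖ ≤ F)
    (hbu : ∀ j ≤ 4, ∀ x, ‖iteratedDeriv j u x‖ ≤ G) {t : ℝ} (ht : 0 ≤ t) (p : ℝ) :
    ‖∫ τ in (0 : ℝ)..t, oscConv v u a b τ p‖ ≤ F * G * (b - a) +
      2 * (F * G) * ((b - a) ^ (5 - 2 * δ) / (5 - 2 * δ)) * (1 / (δ - 1)) := by
  have hκ : 0 ≤ (b - a) ^ (5 - 2 * δ) / (5 - 2 * δ) :=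
    div_nonneg (Real.rpow_nonneg (by linarith) _) (by linarith)
  refine norm_intervalIntegral_le_of_decay (continuous_oscConv_left hv.continuous hu.continuous
    a b p) ?_ (by positivity) (by linarith) ht
    (fun τ _ _ => norm_oscConv_le hab hF (fun x _ => by simpa using hbv 0 (by norm_num) x)
      (fun x => by simpa using hbu 0 (by norm_num) x) τ p) fun τ hτ => ?_
  · have : 0 ≤ b - a := by linarith
    positivity
  · rw [norm_oscConv]
    exact (norm_integral_conv_cexp_le (by linarith) hab hz h0.le h1 hv hu hvs hus hF hG hbv
      hbu).trans_eq (by ring)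

/-- The weight τ lowers the decay exponent to δ-1, whence 1/(δ-2) and the need for δ > 2. The factor
max |a| |b| + 4 bounds the derivatives of y v(y). -/
theorem norm_integral_id_mul_oscConv_le (hab : a ≤ b) (hz : (0 : ℝ) ∉ Icc p₁ p₂) (h0 : 2 < δ)
    (h1 : δ < 5 / 2) (hv : ContDiff ℝ 4 v) (hu : ContDiff ℝ 4 u) (hvs : tsupport v ⊆ Icc a b)
    (hus : tsupport u ⊆ Icc p₁ p₂) (hF : 0 ≤ F) (hG : 0 ≤ G)
    (hbv : ∀ j ≤ 4, ∀ x, ‖iteratedDeriv j v x‖ ≤ F)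
    (hbu : ∀ j ≤ 4, ∀ x, ‖iteratedDeriv j u x‖ ≤ G) {t : ℝ} (ht : 0 ≤ t) (p : ℝ) :
    ‖∫ τ in (0 : ℝ)..t, τ * oscConv (fun y => y * v y) u a b τ p‖ ≤
      max |a| |b| * F * G * (b - a) + 2 * ((max |a| |b| + 4) * F * G) *
        ((b - a) ^ (5 - 2 * δ) / (5 - 2 * δ)) * (1 / (δ - 2)) := by
  have hκ : 0 ≤ (b - a) ^ (5 - 2 * δ) / (5 - 2 * δ) :=
    div_nonneg (Real.rpow_nonneg (by linarith) _) (by linarith)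
  have hm : 0 ≤ max |a| |b| := le_max_of_le_left (abs_nonneg a)
  have hba : 0 ≤ b - a := by linarith
  have hv' : ContDiff ℝ 4 fun y : ℝ => (y : ℂ) * v y := Complex.ofRealCLM.contDiff.mul hv
  have hvs' : tsupport (fun y : ℝ => (y : ℂ) * v y) ⊆ Icc a b := (tsupport_mul_subset_right).trans hvs
  rw [show δ - 2 = (δ - 1) - 1 by ring]
  refine norm_intervalIntegral_le_of_decay (f := fun τ => τ * oscConv (fun y => y * v y) u a b τ p)
    (Complex.continuous_ofReal.mul (continuous_oscConv_left hv'.continuous hu.continuous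
    a b p)) (by positivity) (by positivity)
    (by linarith) ht (fun τ hτ hτ1 => ?_) fun τ hτ => ?_
  · have := norm_oscConv_le (v := fun y => y * v y) (F := max |a| |b| * F) hab (by positivity)
      (fun x hx => by
        rw [norm_mul, Complex.norm_real, Real.norm_eq_abs]
        exact mul_le_mul (abs_le_max_abs_abs hx.1 hx.2) (by simpa using hbv 0 (by norm_num) x)
          (norm_nonneg _) hm)
      (fun x => by simpa using hbu 0 (by norm_num) x) τ p
    rw [norm_mul, Complex.norm_real, Real.norm_of_nonneg hτ]
    exact (mul_le_of_le_one_left (norm_nonneg _) hτ1).trans this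
  · have hτ0 : 0 < τ := by linarith
    rw [norm_mul, norm_oscConv, Complex.norm_real, Real.norm_of_nonneg hτ0.le]
    have := norm_integral_conv_cexp_le (p := p) hτ0 hab hz h0.le h1 hv' hu hvs' hus
      (F := (max |a| |b| + 4) * F) (by positivity) hG
      (by exact_mod_cast norm_iteratedDeriv_id_mul_le (n := 4) (by exact_mod_cast hv) hvs hF hbv) hbu
    refine (mul_le_mul_of_nonneg_left this hτ0.le).trans_eq ?_
    rw [show -(δ - 1) = -δ + 1 by ring, Real.rpow_add hτ0, Real.rpow_one]
    ring

theorem one_le_constM_base : 1 ≤ 3 * √Real.pi / 8 + √(9 * Real.pi / 64 + 1 / 2) := by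
  have h1 : 1 ≤ √Real.pi := Real.one_le_sqrt.2 (by linarith [Real.pi_gt_three])
  have h2 : 7 / 10 ≤ √(9 * Real.pi / 64 + 1 / 2) :=
    Real.le_sqrt_of_sq_le (by linarith [Real.pi_pos])
  linarith

/-- The estimates above produce no base factor; as it is at least 1, the constants of the theorem
dominate. -/
theorem rpow_le_constM_kappa (hab : a ≤ b) (h0 : 2 ≤ δ) : (b - a) ^ (5 - 2 * δ) ≤
    (3 * √Real.pi / 8 + √(9 * Real.pi / 64 + 1 / 2)) ^ (2 * δ - 4) * (b - a) ^ (5 - 2 * δ) :=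
  le_mul_of_one_le_left (Real.rpow_nonneg (by linarith) _)
    (Real.one_le_rpow one_le_constM_base (by linarith))

theorem norm_neg_I_div_two_pi : ‖-(Complex.I / (2 * Real.pi))‖ = 1 / (2 * Real.pi) := by
  rw [norm_neg, norm_div, Complex.norm_I, norm_mul, Complex.norm_real,
    Real.norm_of_nonneg Real.pi_pos.le]
  simp

/-- The kernel constant without its base factor is dominated by the one with it. -/
theorem rpow_div_le_constM_kappa {c : ℝ} (hab : a ≤ b) (h0 : 2 ≤ δ) (h1 : δ < 5 / 2) (hc : 0 ≤ c) :
    0 ≤ (b - a) ^ (5 - 2 * δ) / (5 - 2 * δ) * c ∧ (b - a) ^ (5 - 2 * δ) / (5 - 2 * δ) * c ≤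
      ((3 * √Real.pi / 8 + √(9 * Real.pi / 64 + 1 / 2)) ^ (2 * δ - 4) * (b - a) ^ (5 - 2 * δ)) /
        (5 - 2 * δ) * c := by
  have hd : 0 < 5 - 2 * δ := by linarith
  have hκ0 : 0 ≤ (b - a) ^ (5 - 2 * δ) := Real.rpow_nonneg (by linarith) _
  have hκ := rpow_le_constM_kappa hab h0
  exact ⟨by positivity, by gcongr⟩

theorem norm_amplitudeW_le (hab : a ≤ b) (hz : (0 : ℝ) ∉ Icc p₁ p₂) (h0 : 2 < δ)
    (h1 : δ < 5 / 2) (hv : ContDiff ℝ 4 v) (hu : ContDiff ℝ 4 u) (hvs : tsupport v ⊆ Icc a b)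
    (hus : tsupport u ⊆ Icc p₁ p₂) (hF : 0 ≤ F) (hG : 0 ≤ G)
    (hbv : ∀ j ≤ 4, ∀ x, ‖iteratedDeriv j v x‖ ≤ F)
    (hbu : ∀ j ≤ 4, ∀ x, ‖iteratedDeriv j u x‖ ≤ G) {t : ℝ} (ht : 0 ≤ t) (p : ℝ) :
    ‖amplitudeW v u a b t p‖ ≤ constM1 δ a b * (F * G) := by
  have h := norm_integral_oscConv_le hab hz h0 h1 hv hu hvs hus hF hG hbv hbu ht p
  have hπ : 1 / (2 * Real.pi) ≤ 1 / 6 :=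
    one_div_le_one_div_of_le (by norm_num) (by linarith [Real.pi_gt_three])
  rw [amplitudeW_eq, norm_mul, norm_neg_I_div_two_pi]
  refine (mul_le_mul hπ h (norm_nonneg _) (by norm_num)).trans ?_
  obtain ⟨hr, hR⟩ := rpow_div_le_constM_kappa (c := 1 / (δ - 1)) hab h0.le h1
    (one_div_nonneg.2 (by linarith))
  have e : constM1 δ a b = (b - a) + 5 * ((3 * √Real.pi / 8 + √(9 * Real.pi / 64 + 1 / 2)) ^
      (2 * δ - 4) * (b - a) ^ (5 - 2 * δ) / (5 - 2 * δ) * (1 / (δ - 1))) := by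
    rw [constM1, div_eq_mul_inv 5, mul_inv]
    ring
  have hba : 0 ≤ b - a := by linarith
  have hFG : 0 ≤ F * G := mul_nonneg hF hG
  rw [e, mul_assoc (2 * (F * G))]
  generalize (b - a) ^ (5 - 2 * δ) / (5 - 2 * δ) * (1 / (δ - 1)) = r at hr hR ⊢
  have h2 : 1 / 6 * (b - a + 2 * r) ≤ b - a + 5 * ((3 * √Real.pi / 8 +
      √(9 * Real.pi / 64 + 1 / 2)) ^ (2 * δ - 4) * (b - a) ^ (5 - 2 * δ) / (5 - 2 * δ) *
        (1 / (δ - 1))) := by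
    generalize _ / (5 - 2 * δ) * (1 / (δ - 1)) = R at hR ⊢
    linarith
  exact le_trans (le_of_eq (by ring)) (mul_le_mul_of_nonneg_right h2 hFG)

theorem norm_deriv_amplitudeW_le_add (hv : Continuous v) (hu : ContDiff ℝ 1 u) {t p A B : ℝ}
    (hA : ‖∫ τ in (0 : ℝ)..t, oscConv v (deriv u) a b τ p‖ ≤ A)
    (hB : ‖∫ τ in (0 : ℝ)..t, τ * oscConv (fun y => y * v y) u a b τ p‖ ≤ B) :
    ‖deriv (amplitudeW v u a b t) p‖ ≤ 1 / 6 * (A + 2 * B) := by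
  have hπ : 1 / (2 * Real.pi) ≤ 1 / 6 :=
    one_div_le_one_div_of_le (by norm_num) (by linarith [Real.pi_gt_three])
  have c1 : Continuous fun τ => oscConv v (deriv u) a b τ p :=
    continuous_oscConv_left hv (hu.continuous_deriv le_rfl) a b p
  have hv' : Continuous fun y : ℝ => (y : ℂ) * v y := Complex.continuous_ofReal.mul hv
  have c2 : Continuous fun τ : ℝ => τ * oscConv (fun y => y * v y) u a b τ p :=
    Complex.continuous_ofReal.mul (continuous_oscConv_left hv' hu.continuous a b p)
  have e : ∫ τ in (0 : ℝ)..t, (oscConv v (deriv u) a b τ p +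
        2 * Complex.I * τ * oscConv (fun y => y * v y) u a b τ p) =
      (∫ τ in (0 : ℝ)..t, oscConv v (deriv u) a b τ p) +
        2 * Complex.I * ∫ τ in (0 : ℝ)..t, τ * oscConv (fun y => y * v y) u a b τ p := by
    rw [← intervalIntegral.integral_const_mul, ← intervalIntegral.integral_add
      (c1.intervalIntegrable _ _) ((c2.const_mul _).intervalIntegrable _ _)]
    simp_rw [mul_assoc]
  rw [(hasDerivAt_amplitudeW hv hu a b t p).deriv, norm_mul, norm_neg_I_div_two_pi, e]
  clear e c1 c2
  generalize (∫ τ in (0 : ℝ)..t, oscConv v (deriv u) a b τ p) = X at hA ⊢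
  generalize (∫ τ in (0 : ℝ)..t, τ * oscConv (fun y => y * v y) u a b τ p) = Y at hB ⊢
  have hn : ‖2 * Complex.I * Y‖ = 2 * ‖Y‖ := by simp
  have hsum := norm_add_le X (2 * Complex.I * Y)
  exact mul_le_mul hπ (by linarith) (norm_nonneg _) (by norm_num)

theorem constM2_eq (δ a b : ℝ) : constM2 δ a b = (b - a) + 5 * ((3 * √Real.pi / 8 +
      √(9 * Real.pi / 64 + 1 / 2)) ^ (2 * δ - 4) * (b - a) ^ (5 - 2 * δ) / (5 - 2 * δ) *
        (1 / (δ - 1))) +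
      max |a| |b| * (b - a) + (4 + 10 * max |a| |b|) * ((3 * √Real.pi / 8 +
        √(9 * Real.pi / 64 + 1 / 2)) ^ (2 * δ - 4) * (b - a) ^ (5 - 2 * δ) / (5 - 2 * δ) *
        (1 / (δ - 2))) := by
  rw [constM2, div_eq_mul_inv 5, mul_inv, show 15 - 6 * δ = 3 * (5 - 2 * δ) by ring]
  generalize (3 * √Real.pi / 8 + √(9 * Real.pi / 64 + 1 / 2)) ^ (2 * δ - 4) = X
  generalize (b - a) ^ (5 - 2 * δ) = Y
  rw [one_div (_ * _), mul_inv, mul_inv]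
  ring

/-- Here N = FG, A = b-a and m = max |a| |b|; r, s are the tail terms for δ-1, δ-2, and R, S the
same with the base factor. The 1/6 bounds 1/(2π), and the 2 before the second bracket comes from the
derivative of the phase. -/
theorem constM2_arithmetic {N A m r R s S : ℝ} (hN : 0 ≤ N) (hA : 0 ≤ A) (hm : 0 ≤ m)
    (hr : 0 ≤ r) (hR : r ≤ R) (hs : 0 ≤ s) (hS : s ≤ S) :
    1 / 6 * ((N * A + 2 * N * r) + 2 * (m * N * A + 2 * ((m + 4) * N) * s)) ≤
      (A + 5 * R + m * A + (4 + 10 * m) * S) * N := by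
  have h1 : m * s ≤ m * S := mul_le_mul_of_nonneg_left hS hm
  have h2 : 0 ≤ m * s := mul_nonneg hm hs
  have h3 : 0 ≤ m * A := mul_nonneg hm hA
  have h4 : 1 / 6 * (A + 2 * r + 2 * (m * A + 2 * ((m + 4) * s))) ≤
      A + 5 * R + m * A + (4 + 10 * m) * S := by linarith
  exact le_trans (le_of_eq (by ring)) (mul_le_mul_of_nonneg_right h4 hN)

theorem norm_deriv_amplitudeW_le (hab : a ≤ b) (hz : (0 : ℝ) ∉ Icc p₁ p₂) (h0 : 2 < δ)
    (h1 : δ < 5 / 2) (hv : ContDiff ℝ 4 v) (hu : ContDiff ℝ 5 u) (hvs : tsupport v ⊆ Icc a b)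
    (hus : tsupport u ⊆ Icc p₁ p₂) (hF : 0 ≤ F) (hG : 0 ≤ G)
    (hbv : ∀ j ≤ 4, ∀ x, ‖iteratedDeriv j v x‖ ≤ F)
    (hbu : ∀ j ≤ 5, ∀ x, ‖iteratedDeriv j u x‖ ≤ G) {t : ℝ} (ht : 0 ≤ t) (p : ℝ) :
    ‖deriv (amplitudeW v u a b t) p‖ ≤ constM2 δ a b * (F * G) := by
  have hu4 : ContDiff ℝ 4 u := hu.of_le (by norm_num)
  have hu1 : ContDiff ℝ 1 u := hu.of_le (by norm_num)
  have hdu : ContDiff ℝ 4 (deriv u) := by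
    have := hu.iterate_deriv' 4 1
    simpa using this
  -- Four derivatives of u' are used here, which is where the fifth derivative of û₀ enters.
  have hA := norm_integral_oscConv_le hab hz h0 h1 hv hdu hvs (tsupport_deriv_subset.trans hus) hF hG
    hbv (fun j hj x => by rw [← iteratedDeriv_succ']; exact hbu (j + 1) (by omega) x) ht p
  have hB := norm_integral_id_mul_oscConv_le hab hz h0 h1 hv hu4 hvs hus hF hG hbv
    (fun j hj x => hbu j (by omega) x) ht p
  refine (norm_deriv_amplitudeW_le_add hv.continuous hu1 hA hB).trans ?_
  obtain ⟨hr, hR⟩ := rpow_div_le_constM_kappa (c := 1 / (δ - 1)) hab h0.le h1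
    (one_div_nonneg.2 (by linarith))
  obtain ⟨hr', hR'⟩ := rpow_div_le_constM_kappa (c := 1 / (δ - 2)) hab h0.le h1
    (one_div_nonneg.2 (by linarith))
  have := constM2_arithmetic (mul_nonneg hF hG) (sub_nonneg.2 hab)
    (le_max_of_le_left (abs_nonneg a) : 0 ≤ max |a| |b|) hr hR hr' hR'
  rw [constM2_eq]
  refine le_trans (le_of_eq ?_) this
  rw [mul_assoc (2 * (F * G)), mul_assoc (2 * _) _ (1 / (δ - 2)), mul_assoc (max |a| |b|) F G,
    mul_assoc (max |a| |b| + 4) F G]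

theorem constM1_pos (hab : a < b) (h0 : 2 < δ) (h1 : δ < 5 / 2) : 0 < constM1 δ a b := by
  have h : 0 < b - a := sub_pos.2 hab
  have d1 : 0 < 5 - 2 * δ := by linarith
  have d2 : 0 < δ - 1 := by linarith
  unfold constM1
  positivity

theorem constM2_pos (hab : a < b) (h0 : 2 < δ) (h1 : δ < 5 / 2) : 0 < constM2 δ a b := by
  have h : 0 < b - a := sub_pos.2 hab
  have d1 : 0 < 5 - 2 * δ := by linarith
  have d2 : 0 < δ - 1 := by linarith
  have d3 : 0 < δ - 2 := by linarith
  have d4 : 0 < 15 - 6 * δ := by linarith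
  unfold constM2
  positivity

theorem constK_pos {L : ℝ} (hδ : δ < 1) (hL : 0 < L) : 0 < constK δ L := by
  have d1 : 0 < 4 - 4 * δ := by linarith
  have hπ := Real.pi_pos
  unfold constK
  positivity

end Bounds

/-! ### Inverse Fourier transform on L² and multiplication operators. -/

open FourierTransform in
-- Fubini's multiplication formula for the forward transform, applied to the reflection of g.
theorem integral_fourierInv_smul_eq_integral_smul_fourierInv {φ g : ℝ → ℂ} (hφ : Integrable φ)
    (hg : Integrable g) : ∫ ξ, (𝓕⁻ φ) ξ • g ξ = ∫ x, φ x • (𝓕⁻ g) x := by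
  have h := VectorFourier.integral_fourierIntegral_smul_eq_flip (L := innerₗ ℝ) (μ := volume)
    (ν := volume) Real.continuous_fourierChar continuous_inner hφ hg.comp_neg
  rw [← integral_neg_eq_self]
  rw [Real.fourierInv_eq_fourier_comp_neg g]
  simp_rw [Real.fourierInv_eq_fourier_neg, neg_neg]
  simpa using! h

open FourierTransform in
theorem continuous_fourierInv {g : ℝ → ℂ} (hg : Integrable g) : Continuous (𝓕⁻ g) := by
  rw [Real.fourierInv_eq_fourier_comp_neg]
  exact VectorFourier.fourierIntegral_continuous Real.continuous_fourierChar continuous_inner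
    hg.comp_neg

open FourierTransform in
/-- On continuous functions with compact support the inverse Fourier transform of `L²` is given by
the inverse Fourier integral. -/
theorem fourierInv_toLp_ae_eq {g : ℝ → ℂ} (hg : Integrable g) (h2 : MemLp g 2) :
    ((Lp.fourierTransformₗᵢ ℝ ℂ).symm h2.toLp : ℝ → ℂ) =ᵐ[volume] 𝓕⁻ g := by
  -- Test functions are Schwartz, so the L² transform moves onto them by duality and returns as an
  -- integral onto g.
  refine ae_eq_of_integral_contDiff_smul_eq ((Lp.memLp _).locallyIntegrable (by norm_num))
    (continuous_fourierInv hg).locallyIntegrable fun φ hφ hφs => ?_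
  have hφ1 : HasCompactSupport (Complex.ofRealCLM ∘ φ) := hφs.comp_left rfl
  have hφ2 : ContDiff ℝ ((⊤ : ℕ∞) : WithTop ℕ∞) (Complex.ofRealCLM ∘ φ) := Complex.ofRealCLM.contDiff.comp hφ
  let ψ : SchwartzMap ℝ ℂ := hφ1.toSchwartzMap hφ2
  let f : Lp ℂ 2 (volume : Measure ℝ) := h2.toLp
  have h := congrArg (fun T => T ψ) (Lp.fourierInv_toTemperedDistribution_eq f)
  simp only [TemperedDistribution.fourierInv_apply, Lp.toTemperedDistribution_apply] at h
  calc ∫ x, φ x • ((Lp.fourierTransformₗᵢ ℝ ℂ).symm h2.toLp : ℝ → ℂ) x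
      = ∫ x, ψ x • (𝓕⁻ f : Lp ℂ 2 (volume : Measure ℝ)) x := by
        congr 1
    _ = ∫ x, (𝓕⁻ ψ) x • f x := h.symm
    _ = ∫ x, (𝓕⁻ (ψ : ℝ → ℂ)) x • g x := by
        refine integral_congr_ae ?_
        filter_upwards [h2.coeFn_toLp] with x hx
        rw [hx, SchwartzMap.fourierInv_coe]
    _ = ∫ x, ψ x • (𝓕⁻ g) x :=
        integral_fourierInv_smul_eq_integral_smul_fourierInv ψ.integrable hg
    _ = _ := by congr 1

open FourierTransform Convolution in
theorem fourierInv_mul_convolution_eq {f g : ℝ → ℂ} (hf : Integrable f) (hg : Integrable g)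
    (x : ℝ) : (𝓕⁻ (f ⋆[ContinuousLinearMap.mul ℂ ℂ] g)) x = (𝓕⁻ f) x * (𝓕⁻ g) x := by
  simp only [Real.fourierInv_eq_fourier_neg]
  exact Real.fourier_mul_convolution_eq hf hg (-x)

theorem mulL2_eq_toLp {m g : ℝ → ℂ} {f : L2R} (hg : MemLp g 2)
    (h : (fun x => m x * f x) =ᵐ[volume] g) : mulL2 m f = hg.toLp := by
  have hm : MemLp (fun x => m x * f x) 2 := (memLp_congr_ae h).2 hg
  rw [mulL2, dif_pos hm]
  exact MemLp.toLp_congr hm hg h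

/-! ### Bochner integrals in L² of continuous families with common compact support. -/

theorem eLpNorm_extend_le (K : Set ℝ) [CompactSpace K] (φ : C(K, ℂ)) :
    eLpNorm (Function.extend (Subtype.val : K → ℝ) φ 0) 2 volume ≤
      ENNReal.ofReal ‖φ‖ * volume K ^ (1 / (2 : ENNReal).toReal) := by
  have hK : IsCompact K := isCompact_iff_compactSpace.2 inferInstance
  have := eLpNorm_sub_le_of_dist_bdd (μ := volume) (p := 2) (by norm_num) hK.measurableSet
    (norm_nonneg φ) (f := Function.extend (Subtype.val : K → ℝ) φ 0) (g := 0)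
    (fun x => ?_) (fun x hx => ?_) (by simp)
  · simpa using this
  · by_cases hx : ∃ y : K, (y : ℝ) = x
    · obtain ⟨y, rfl⟩ := hx
      rw [Subtype.val_injective.extend_apply]
      simpa using φ.norm_coe_le_norm y
    · rw [Function.extend_apply' _ _ _ hx]
      simp
  · by_contra hn
    exact hx (Function.extend_apply' _ _ _ fun ⟨y, hy⟩ => hn (hy ▸ y.2))

theorem rpow_volume_lt_top (K : Set ℝ) [CompactSpace K] :
    volume K ^ (1 / (2 : ENNReal).toReal) < ⊤ :=
  ENNReal.rpow_lt_top_of_nonneg (by norm_num)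
    (isCompact_iff_compactSpace.2 (inferInstance : CompactSpace K)).measure_lt_top.ne

theorem memLp_extend (K : Set ℝ) [CompactSpace K] (φ : C(K, ℂ)) :
    MemLp (Function.extend (Subtype.val : K → ℝ) φ 0) 2 volume :=
  ⟨((MeasurableEmbedding.subtype_coe (isCompact_iff_compactSpace.2
    (inferInstance : CompactSpace K)).measurableSet).measurable_extend
      φ.continuous.measurable measurable_zero).aestronglyMeasurable,
    (eLpNorm_extend_le K φ).trans_lt
      (ENNReal.mul_lt_top ENNReal.ofReal_lt_top (rpow_volume_lt_top K))⟩

/-- Extension by zero of continuous functions on a compact set, as functions in `L²`. -/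
noncomputable def extendToL2 (K : Set ℝ) [CompactSpace K] : C(K, ℂ) →L[ℂ] L2R :=
  LinearMap.mkContinuous
    { toFun := fun φ => (memLp_extend K φ).toLp
      map_add' := fun φ ψ => by
        rw [← MemLp.toLp_add]
        congr 1
        ext x
        by_cases hx : ∃ y : K, (y : ℝ) = x
        · obtain ⟨y, rfl⟩ := hx
          simp
        · simp [Function.extend_apply' _ _ _ hx]
      map_smul' := fun c φ => by
        rw [RingHom.id_apply, ← MemLp.toLp_const_smul]
        congr 1
        ext x
        by_cases hx : ∃ y : K, (y : ℝ) = x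
        · obtain ⟨y, rfl⟩ := hx
          simp
        · simp [Function.extend_apply' _ _ _ hx] }
    (volume K ^ (1 / (2 : ENNReal).toReal)).toReal
    fun φ => by
      change ‖(memLp_extend K φ).toLp‖ ≤ _
      rw [Lp.norm_toLp]
      refine (ENNReal.toReal_mono ?_ (eLpNorm_extend_le K φ)).trans_eq ?_
      · exact (ENNReal.mul_lt_top ENNReal.ofReal_lt_top (rpow_volume_lt_top K)).ne
      · rw [ENNReal.toReal_mul, ENNReal.toReal_ofReal (norm_nonneg φ), mul_comm]

theorem extendToL2_ae_eq (K : Set ℝ) [CompactSpace K] (φ : C(K, ℂ)) :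
    extendToL2 K φ =ᵐ[volume] Function.extend (Subtype.val : K → ℝ) φ 0 :=
  MemLp.coeFn_toLp (memLp_extend K φ)

theorem extendToL2_ae_eq_of_forall {K : Set ℝ} [CompactSpace K] {φ : C(K, ℂ)} {g : ℝ → ℂ}
    (hφ : ∀ y : K, φ y = g y) (hg : ∀ x, x ∉ K → g x = 0) : extendToL2 K φ =ᵐ[volume] g := by
  refine (extendToL2_ae_eq K φ).trans (Eventually.of_forall fun x => ?_)
  by_cases hx : x ∈ K
  · exact (Subtype.val_injective.extend_apply φ 0 ⟨x, hx⟩).trans (hφ ⟨x, hx⟩)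
  · rw [Function.extend_apply' _ _ _ fun ⟨y, hy⟩ => hx (hy ▸ y.2), hg x hx]
    rfl

theorem memLp_of_continuous_uncurry {G : ℝ → ℝ → ℂ} {K : Set ℝ} (hG : Continuous (Function.uncurry G))
    (hK : IsCompact K) (hGK : ∀ τ ξ, ξ ∉ K → G τ ξ = 0) (τ : ℝ) : MemLp (G τ) 2 := by
  have hc : Continuous (G τ) := hG.comp (by fun_prop : Continuous fun ξ => (τ, ξ))
  exact hc.memLp_of_hasCompactSupport (HasCompactSupport.intro hK (hGK τ))

/-- Currying makes the family continuous into C(K) with the sup norm; extension by zero into L² is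
bounded. -/
theorem continuous_toLp_of_continuous_uncurry {G : ℝ → ℝ → ℂ} {K : Set ℝ} (hG : Continuous (Function.uncurry G))
    (hK : IsCompact K) (hGK : ∀ τ ξ, ξ ∉ K → G τ ξ = 0) :
    Continuous fun τ => (memLp_of_continuous_uncurry hG hK hGK τ).toLp := by
  have := isCompact_iff_compactSpace.1 hK
  let Γ : C(ℝ, C(K, ℂ)) := ContinuousMap.curry ⟨fun x : ℝ × K => G x.1 x.2,
    hG.comp (by fun_prop : Continuous fun x : ℝ × K => (x.1, (x.2 : ℝ)))⟩
  have h : (fun τ => (memLp_of_continuous_uncurry hG hK hGK τ).toLp) =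
      fun τ => extendToL2 K (Γ τ) := by
    ext1 τ
    refine Lp.ext ((MemLp.coeFn_toLp _).trans ?_)
    exact (extendToL2_ae_eq_of_forall (fun y => rfl) (hGK τ)).symm
  rw [h]
  exact (extendToL2 K).continuous.comp Γ.continuous

/-- Points cannot be evaluated in L², but they can in C(K): the Bochner integral taken there
commutes with evaluation and with extension. -/
theorem integral_toLp_ae_eq {G : ℝ → ℝ → ℂ} {K : Set ℝ} (hG : Continuous (Function.uncurry G))
    (hK : IsCompact K) (hGK : ∀ τ ξ, ξ ∉ K → G τ ξ = 0)
    (a b : ℝ) :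
    ((∫ τ in a..b, (memLp_of_continuous_uncurry hG hK hGK τ).toLp : L2R) : ℝ → ℂ) =ᵐ[volume]
      fun ξ => ∫ τ in a..b, G τ ξ := by
  have := isCompact_iff_compactSpace.1 hK
  let Γ : C(ℝ, C(K, ℂ)) := ContinuousMap.curry ⟨fun x : ℝ × K => G x.1 x.2,
    hG.comp (by fun_prop : Continuous fun x : ℝ × K => (x.1, (x.2 : ℝ)))⟩
  have h : (fun τ => (memLp_of_continuous_uncurry hG hK hGK τ).toLp) =
      fun τ => extendToL2 K (Γ τ) := by
    ext1 τ
    refine Lp.ext ((MemLp.coeFn_toLp _).trans ?_)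
    exact (extendToL2_ae_eq_of_forall (fun y => rfl) (hGK τ)).symm
  rw [h, ContinuousLinearMap.intervalIntegral_comp_comm _ (Γ.continuous.intervalIntegrable a b)]
  refine extendToL2_ae_eq_of_forall (fun y => ?_) fun x hx => by simp [hGK _ x hx]
  have := (ContinuousMap.evalCLM ℂ y).intervalIntegral_comp_comm
    (Γ.continuous.intervalIntegrable (μ := volume) a b)
  exact this.symm

/-! ### Pointwise bounds from the Sobolev norm; change of frequency variable. -/

theorem norm_iteratedDeriv_le_sobolevInftyNorm {n m : ℕ} {g : ℝ → ℂ} (hg : ContDiff ℝ n g)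
    (hs : HasCompactSupport g) (hm : m ≤ n) :
    ∀ j ≤ m, ∀ x, ‖iteratedDeriv j g x‖ ≤ sobolevInftyNorm m g := by
  intro j hj x
  have hc : ∀ i ≤ m, Continuous (iteratedDeriv i g) := fun i hi =>
    hg.continuous_iteratedDeriv i (by exact_mod_cast hi.trans hm)
  -- Finiteness matters because `toReal` sends ⊤ to 0.
  have hfin : ((Finset.range (m + 1)).sup
      fun j => eLpNorm (iteratedDeriv j g) ⊤ volume) < ⊤ := by
    rw [Finset.sup_lt_iff (by simp)]
    intro i hi
    exact ((hc i (by simpa [Nat.lt_succ_iff] using hi)).memLp_top_of_hasCompactSupport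
      (hasCompactSupport_iteratedDeriv hs i) volume).2
  have hle : ‖iteratedDeriv j g x‖ₑ ≤ eLpNorm (iteratedDeriv j g) ⊤ volume := by
    rw [eLpNorm_exponent_top]
    -- The essential bound holds on a set of full measure, hence dense; continuity makes it closed,
    -- hence everything.
    have hd : Dense {y | ‖iteratedDeriv j g y‖ₑ ≤ eLpNormEssSup (iteratedDeriv j g) volume} :=
      Measure.dense_of_ae (enorm_ae_le_eLpNormEssSup _ volume)
    have hcl : IsClosed {y | ‖iteratedDeriv j g y‖ₑ ≤ eLpNormEssSup (iteratedDeriv j g) volume} :=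
      isClosed_le (hc j hj).enorm continuous_const
    have : x ∈ {y | ‖iteratedDeriv j g y‖ₑ ≤ eLpNormEssSup (iteratedDeriv j g) volume} := by
      rw [← hcl.closure_eq, hd.closure_eq]
      exact mem_univ x
    exact this
  have h := hle.trans (Finset.le_sup (f := fun j => eLpNorm (iteratedDeriv j g) ⊤ volume)
    (Finset.mem_range.2 (Nat.lt_succ_of_le hj)))
  have := ENNReal.toReal_mono hfin.ne h
  rwa [toReal_enorm] at this

theorem sobolevInftyNorm_nonneg (m : ℕ) (g : ℝ → ℂ) : 0 ≤ sobolevInftyNorm m g :=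
  ENNReal.toReal_nonneg

theorem fourierTransform_ae_eq_of_hatL2 {f : L2R} {g : ℝ → ℂ} (h : g =ᵐ[volume] hatL2 f) :
    (Lp.fourierTransformₗᵢ ℝ ℂ f : ℝ → ℂ) =ᵐ[volume] fun ξ => g (2 * Real.pi * ξ) := by
  have hπ : 2 * Real.pi ≠ 0 := by positivity
  have hq : Measure.QuasiMeasurePreserving (fun ξ : ℝ => 2 * Real.pi * ξ) volume volume :=
    ⟨by fun_prop, by
      rw [Real.map_volume_mul_left hπ]
      exact Measure.smul_absolutelyContinuous⟩
  filter_upwards [hq.ae_eq_comp h] with ξ hξ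
  simp only [Function.comp_apply, hatL2] at hξ
  rw [hξ, mul_div_cancel_left₀ _ hπ]

/-! ### The second Dyson-Phillips term in frequency space. -/

/-- The symbol of the free Schrödinger evolution in the frequency variable `ξ = p / (2 π)`. -/
noncomputable def freeSymbol (t ξ : ℝ) : ℂ := Complex.exp (-Complex.I * t * (2 * Real.pi * ξ) ^ 2)

theorem continuous_freeSymbol (t : ℝ) : Continuous (freeSymbol t) := by
  unfold freeSymbol
  fun_prop

theorem S1_eq_of_fourierTransform_ae_eq {t : ℝ} {f : L2R} {h : ℝ → ℂ}
    (hf : (Lp.fourierTransformₗᵢ ℝ ℂ f : ℝ → ℂ) =ᵐ[volume] h)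
    (h2 : MemLp (fun ξ => freeSymbol t ξ * h ξ) 2) :
    S1 t f = (Lp.fourierTransformₗᵢ ℝ ℂ).symm h2.toLp := by
  rw [S1]
  congr 1
  refine mulL2_eq_toLp h2 ?_
  filter_upwards [hf] with ξ hξ
  rw [hξ, freeSymbol]

open Convolution in
-- The product of the two inverse transforms is the inverse transform of the convolution. Since the
-- latter is in L², so is the product, and the domain condition in `mulL2` is met.
theorem potentialOp_eq_of_fourierTransform_ae_eq {V : L2R} {v h : ℝ → ℂ}
    (hV : (Lp.fourierTransformₗᵢ ℝ ℂ V : ℝ → ℂ) =ᵐ[volume] v) (hv : Continuous v)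
    (hvs : HasCompactSupport v) (hh : Continuous h) (hhs : HasCompactSupport h)
    (h2 : MemLp h 2)
    (hc2 : MemLp (v ⋆[ContinuousLinearMap.mul ℂ ℂ] h) 2 volume) :
    potentialOp V ((Lp.fourierTransformₗᵢ ℝ ℂ).symm h2.toLp) =
      (Lp.fourierTransformₗᵢ ℝ ℂ).symm (-Complex.I • hc2.toLp) := by
  have hvi : Integrable v := hv.integrable_of_hasCompactSupport hvs
  have hhi : Integrable h := hh.integrable_of_hasCompactSupport hhs
  have hv2 : MemLp v 2 := hv.memLp_of_hasCompactSupport hvs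
  have hVv : V = (Lp.fourierTransformₗᵢ ℝ ℂ).symm hv2.toLp := by
    rw [LinearIsometryEquiv.eq_symm_apply]
    exact Lp.ext (hV.trans hv2.coeFn_toLp.symm)
  have e := mulL2_eq_toLp (m := fun x => -Complex.I * V x)
    (f := (Lp.fourierTransformₗᵢ ℝ ℂ).symm h2.toLp)
    (Lp.memLp ((Lp.fourierTransformₗᵢ ℝ ℂ).symm (-Complex.I • hc2.toLp))) ?_
  · rw [potentialOp, e, Lp.toLp_coeFn]
  · rw [map_smul]
    have hci : Integrable (v ⋆[ContinuousLinearMap.mul ℂ ℂ] h) volume :=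
      Integrable.integrable_convolution (μ := volume) (ContinuousLinearMap.mul ℂ ℂ) hvi hhi
    have h1 := fourierInv_toLp_ae_eq hvi hv2
    rw [← hVv] at h1
    filter_upwards [h1, fourierInv_toLp_ae_eq hhi h2, fourierInv_toLp_ae_eq hci hc2,
      Lp.coeFn_smul (-Complex.I) ((Lp.fourierTransformₗᵢ ℝ ℂ).symm hc2.toLp)] with x h1 h2 h3 h4
    rw [h1, h2, h4, Pi.smul_apply, h3, fourierInv_mul_convolution_eq hvi hhi, smul_eq_mul]
    ring

/-- The Fourier transform of the integrand of the second Dyson-Phillips term, in the frequency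
variable `ξ = p / (2 π)`. -/
noncomputable def dysonHat (v u : ℝ → ℂ) (a b t τ ξ : ℝ) : ℂ :=
  freeSymbol t ξ * (-(Complex.I / (2 * Real.pi)) * oscConv v u a b τ (2 * Real.pi * ξ))

theorem continuous_dysonHat {v u : ℝ → ℂ} (hv : Continuous v) (hu : Continuous u) (a b t : ℝ) :
    Continuous (Function.uncurry (dysonHat v u a b t)) := by
  have h : Continuous fun x : ℝ × ℝ => oscConv v u a b x.1 (2 * Real.pi * x.2) := by
    have hs : Continuous fun x : ℝ × ℝ => (x.1, 2 * Real.pi * x.2) := by fun_prop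
    have := (continuous_oscConv hv hu a b).comp hs
    exact this
  have h2 : Continuous fun x : ℝ × ℝ => freeSymbol t x.2 :=
    (continuous_freeSymbol t).comp continuous_snd
  exact h2.mul (continuous_const.mul h)

theorem oscConv_eq_zero {v u : ℝ → ℂ} {a b p₁ p₂ : ℝ} (hvs : tsupport v ⊆ Icc a b)
    (hus : tsupport u ⊆ Icc p₁ p₂) {p : ℝ} (hp : p ∉ Icc (p₁ + a) (p₂ + b)) (τ : ℝ) :
    oscConv v u a b τ p = 0 := by
  have : ∀ y, v y * u (p - y) = 0 := fun y => by
    by_contra h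
    have h1 := hvs (subset_tsupport v (left_ne_zero_of_mul h))
    have h2 := hus (subset_tsupport u (right_ne_zero_of_mul h))
    exact hp ⟨by linarith [h1.1, h2.1], by linarith [h1.2, h2.2]⟩
  simp [oscConv, this]

theorem mem_frequency_interval {q₁ q₂ ξ : ℝ}
    (hξ : ξ ∉ Icc (q₁ / (2 * Real.pi)) (q₂ / (2 * Real.pi))) : 2 * Real.pi * ξ ∉ Icc q₁ q₂ := by
  have hπ : 0 < 2 * Real.pi := by positivity
  intro h
  exact hξ ⟨by rw [div_le_iff₀ hπ]; linarith [h.1], by rw [le_div_iff₀ hπ]; linarith [h.2]⟩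

theorem dysonHat_eq_zero {v u : ℝ → ℂ} {a b p₁ p₂ : ℝ} (hvs : tsupport v ⊆ Icc a b)
    (hus : tsupport u ⊆ Icc p₁ p₂) (t τ ξ : ℝ)
    (hξ : ξ ∉ Icc ((p₁ + a) / (2 * Real.pi)) ((p₂ + b) / (2 * Real.pi))) :
    dysonHat v u a b t τ ξ = 0 := by
  rw [dysonHat, oscConv_eq_zero hvs hus (mem_frequency_interval hξ), mul_zero, mul_zero]

open Convolution in
-- The symbol at t-τ splits as the symbol at t times exp(iτp²); the substitution y = 2πη produces
-- the prefactor 1/(2π).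
theorem freeSymbol_mul_convolution {v u : ℝ → ℂ} {a b : ℝ} (hab : a ≤ b)
    (hvs : tsupport v ⊆ Icc a b) (t τ ξ : ℝ) :
    freeSymbol (t - τ) ξ * (-Complex.I * ((fun ξ => v (2 * Real.pi * ξ))
      ⋆[ContinuousLinearMap.mul ℂ ℂ] fun ξ => freeSymbol τ ξ * u (2 * Real.pi * ξ)) ξ) =
      dysonHat v u a b t τ ξ := by
  have hπ : 0 < 2 * Real.pi := by positivity
  have e : ((fun ξ => v (2 * Real.pi * ξ))
      ⋆[ContinuousLinearMap.mul ℂ ℂ] fun ξ => freeSymbol τ ξ * u (2 * Real.pi * ξ)) ξ =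
      (1 / (2 * Real.pi) : ℂ) * ∫ y in a..b, v y * u (2 * Real.pi * ξ - y) *
        Complex.exp (-Complex.I * τ * (((2 * Real.pi * ξ : ℝ) : ℂ) - y) ^ 2) := by
    rw [intervalIntegral.integral_of_le hab, ← integral_Icc_eq_integral_Ioc,
      setIntegral_eq_integral_of_forall_compl_eq_zero]
    · have := Measure.integral_comp_mul_left (fun y : ℝ => v y * u (2 * Real.pi * ξ - y) *
        Complex.exp (-Complex.I * τ * (((2 * Real.pi * ξ : ℝ) : ℂ) - y) ^ 2)) (2 * Real.pi)
      rw [abs_of_pos (by positivity), Complex.real_smul] at this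
      rw [show (1 / (2 * Real.pi) : ℂ) = (((2 * Real.pi)⁻¹ : ℝ) : ℂ) by push_cast; rw [one_div],
        ← this]
      refine integral_congr_ae (Eventually.of_forall fun η => ?_)
      simp only [ContinuousLinearMap.mul_apply', freeSymbol]
      push_cast
      ring_nf
    · intro y hy
      have : v y = 0 := by
        by_contra h
        exact hy (hvs (subset_tsupport v h))
      rw [this, zero_mul, zero_mul]
  rw [e, dysonHat, ← integral_mul_cexp_eq_oscConv]
  have hf : freeSymbol (t - τ) ξ = freeSymbol t ξ *
      Complex.exp (Complex.I * τ * ((2 * Real.pi * ξ : ℝ) : ℂ) ^ 2) := by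
    rw [freeSymbol, freeSymbol, ← Complex.exp_add]
    congr 1
    push_cast
    ring
  rw [hf]
  ring

theorem hasCompactSupport_comp_mul {g : ℝ → ℂ} (hs : HasCompactSupport g) {c : ℝ} (hc : c ≠ 0) :
    HasCompactSupport fun ξ => g (c * ξ) :=
  hs.comp_homeomorph (Homeomorph.mulLeft₀ c hc)

open Convolution in
theorem S2Integrand_eq {V u₀ : L2R} {v u : ℝ → ℂ} {a b : ℝ} (hab : a ≤ b)
    (hV : v =ᵐ[volume] hatL2 V) (hu₀ : u =ᵐ[volume] hatL2 u₀) (hv : Continuous v)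
    (hu : Continuous u) (hvs : tsupport v ⊆ Icc a b) (hus : HasCompactSupport u) (t τ : ℝ)
    (h2 : MemLp (dysonHat v u a b t τ) 2) :
    S2Integrand V u₀ t τ = (Lp.fourierTransformₗᵢ ℝ ℂ).symm h2.toLp := by
  have hπ : 2 * Real.pi ≠ 0 := by positivity
  have hvk : HasCompactSupport v := isCompact_Icc.of_isClosed_subset (isClosed_tsupport v) hvs
  have hv' : Continuous fun ξ => v (2 * Real.pi * ξ) := by fun_prop
  have hu' : Continuous fun ξ => freeSymbol τ ξ * u (2 * Real.pi * ξ) :=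
    (continuous_freeSymbol τ).mul (by fun_prop)
  have hvk' := hasCompactSupport_comp_mul hvk hπ
  have huk' : HasCompactSupport fun ξ => freeSymbol τ ξ * u (2 * Real.pi * ξ) :=
    (hasCompactSupport_comp_mul hus hπ).mul_left
  have hu2 : MemLp (fun ξ => freeSymbol τ ξ * u (2 * Real.pi * ξ)) 2 :=
    hu'.memLp_of_hasCompactSupport huk'
  have hc2 : MemLp ((fun ξ => v (2 * Real.pi * ξ)) ⋆[ContinuousLinearMap.mul ℂ ℂ]
      fun ξ => freeSymbol τ ξ * u (2 * Real.pi * ξ)) 2 :=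
    (huk'.continuous_convolution_right _ hv'.locallyIntegrable
      hu').memLp_of_hasCompactSupport (hvk'.convolution _ huk')
  rw [S2Integrand, S1_eq_of_fourierTransform_ae_eq (fourierTransform_ae_eq_of_hatL2 hu₀) hu2,
    potentialOp_eq_of_fourierTransform_ae_eq (fourierTransform_ae_eq_of_hatL2 hV) hv' hvk' hu' huk'
      hu2 hc2]
  have he : (fun ξ => freeSymbol (t - τ) ξ * (-Complex.I * ((fun ξ => v (2 * Real.pi * ξ))
      ⋆[ContinuousLinearMap.mul ℂ ℂ] fun ξ => freeSymbol τ ξ * u (2 * Real.pi * ξ)) ξ)) =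
      dysonHat v u a b t τ := funext (freeSymbol_mul_convolution hab hvs t τ)
  have h2' := h2
  rw [← he] at h2'
  refine (S1_eq_of_fourierTransform_ae_eq ?_ h2').trans ?_
  · rw [LinearIsometryEquiv.apply_symm_apply]
    filter_upwards [Lp.coeFn_smul (-Complex.I) hc2.toLp, hc2.coeFn_toLp] with ξ h3 h4
    rw [h3, Pi.smul_apply, h4, smul_eq_mul]
  · congr 1
    exact MemLp.toLp_congr _ _ (Eventually.of_forall (congrFun he))

open FourierTransform in
/-- The continuous representative of the second Dyson-Phillips term. -/
noncomputable def dysonRepr (v u : ℝ → ℂ) (a b t : ℝ) : ℝ → ℂ :=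
  𝓕⁻ (fun ξ => freeSymbol t ξ * amplitudeW v u a b t (2 * Real.pi * ξ))

theorem integral_dysonHat (v u : ℝ → ℂ) (a b t ξ : ℝ) :
    ∫ τ in (0 : ℝ)..t, dysonHat v u a b t τ ξ =
      freeSymbol t ξ * amplitudeW v u a b t (2 * Real.pi * ξ) := by
  simp only [dysonHat, amplitudeW_eq, intervalIntegral.integral_const_mul]

section SecondDysonTerm

variable {V u₀ : L2R} {v u : ℝ → ℂ} {a b p₁ p₂ : ℝ}

theorem continuous_S2Integrand (hab : a ≤ b)
    (hV : v =ᵐ[volume] hatL2 V) (hu₀ : u =ᵐ[volume] hatL2 u₀) (hv : Continuous v)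
    (hu : Continuous u) (hvs : tsupport v ⊆ Icc a b) (hus : tsupport u ⊆ Icc p₁ p₂) (t : ℝ) :
    Continuous (S2Integrand V u₀ t) := by
  have huk : HasCompactSupport u := isCompact_Icc.of_isClosed_subset (isClosed_tsupport u) hus
  have hG := continuous_dysonHat hv hu a b t
  have hK := dysonHat_eq_zero hvs hus t
  rw [funext fun τ => S2Integrand_eq hab hV hu₀ hv hu hvs huk t τ
    (memLp_of_continuous_uncurry hG isCompact_Icc hK τ)]
  exact (LinearIsometryEquiv.continuous _).comp
    (continuous_toLp_of_continuous_uncurry hG isCompact_Icc hK)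

theorem continuous_freeSymbol_mul_amplitudeW (hv : Continuous v) (hu : ContDiff ℝ 1 u) (t : ℝ) :
    Continuous fun ξ => freeSymbol t ξ * amplitudeW v u a b t (2 * Real.pi * ξ) :=
  (continuous_freeSymbol t).mul
    ((contDiff_amplitudeW hv hu a b t).continuous.comp (by fun_prop))

theorem hasCompactSupport_freeSymbol_mul_amplitudeW (hvs : tsupport v ⊆ Icc a b)
    (hus : tsupport u ⊆ Icc p₁ p₂) (t : ℝ) :
    HasCompactSupport fun ξ => freeSymbol t ξ * amplitudeW v u a b t (2 * Real.pi * ξ) := by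
  have hk : HasCompactSupport (amplitudeW v u a b t) := isCompact_Icc.of_isClosed_subset
    (isClosed_tsupport _) (tsupport_amplitudeW_subset hvs hus t)
  exact (hasCompactSupport_comp_mul hk (by positivity)).mul_left

theorem continuous_dysonRepr (hv : Continuous v) (hu : ContDiff ℝ 1 u)
    (hvs : tsupport v ⊆ Icc a b) (hus : tsupport u ⊆ Icc p₁ p₂) (t : ℝ) :
    Continuous (dysonRepr v u a b t) :=
  continuous_fourierInv ((continuous_freeSymbol_mul_amplitudeW hv hu t).integrable_of_hasCompactSupport
    (hasCompactSupport_freeSymbol_mul_amplitudeW hvs hus t))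

/-- The inverse transform, being continuous and linear, leaves the Bochner integral, which is then
computed pointwise in frequency. -/
theorem dysonRepr_ae_eq (hab : a ≤ b)
    (hV : v =ᵐ[volume] hatL2 V) (hu₀ : u =ᵐ[volume] hatL2 u₀) (hv : Continuous v)
    (hu : ContDiff ℝ 1 u) (hvs : tsupport v ⊆ Icc a b) (hus : tsupport u ⊆ Icc p₁ p₂) (t : ℝ) :
    dysonRepr v u a b t =ᵐ[volume] S2 V u₀ t := by
  have huk : HasCompactSupport u := isCompact_Icc.of_isClosed_subset (isClosed_tsupport u) hus
  have hG := continuous_dysonHat hv hu.continuous a b t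
  have hK := dysonHat_eq_zero hvs hus t
  have hc := continuous_freeSymbol_mul_amplitudeW (a := a) (b := b) hv hu t
  have hs := hasCompactSupport_freeSymbol_mul_amplitudeW hvs hus t
  have h2 : MemLp (fun ξ => freeSymbol t ξ * amplitudeW v u a b t (2 * Real.pi * ξ)) 2 :=
    hc.memLp_of_hasCompactSupport hs
  have e : ∫ τ in (0 : ℝ)..t, (memLp_of_continuous_uncurry hG isCompact_Icc hK τ).toLp =
      h2.toLp := by
    refine Lp.ext ((integral_toLp_ae_eq hG isCompact_Icc hK 0 t).trans ?_)
    rw [funext (integral_dysonHat v u a b t)]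
    exact h2.coeFn_toLp.symm
  have hS : S2 V u₀ t = (Lp.fourierTransformₗᵢ ℝ ℂ).symm h2.toLp := by
    rw [S2, funext fun τ => S2Integrand_eq hab hV hu₀ hv hu.continuous hvs huk t τ
      (memLp_of_continuous_uncurry hG isCompact_Icc hK τ), ← e]
    exact ContinuousLinearMap.intervalIntegral_comp_comm
      (Lp.fourierTransformₗᵢ ℝ ℂ).symm.toContinuousLinearEquiv.toContinuousLinearMap
      ((continuous_toLp_of_continuous_uncurry hG isCompact_Icc hK).intervalIntegrable 0 t)
  rw [hS]
  exact (fourierInv_toLp_ae_eq (hc.integrable_of_hasCompactSupport hs) h2).symm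

/-- Complete the square: xp - tp² = x²/(4t) - t(p - x/(2t))². -/
theorem dysonRepr_eq_integral (v u : ℝ → ℂ) (a b : ℝ) {t : ℝ} (ht : t ≠ 0) (x : ℝ) :
    dysonRepr v u a b t x = 1 / (2 * Real.pi) * Complex.exp (Complex.I * x ^ 2 / (4 * t)) *
      ∫ p, amplitudeW v u a b t p *
        Complex.exp (-Complex.I * t * (p - ((x / (2 * t) : ℝ) : ℂ)) ^ 2) := by
  have hπ : 0 < 2 * Real.pi := by positivity
  have htc : (t : ℂ) ≠ 0 := Complex.ofReal_ne_zero.2 ht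
  have := Measure.integral_comp_mul_left (fun p : ℝ => amplitudeW v u a b t p *
        Complex.exp (-Complex.I * t * (p - ((x / (2 * t) : ℝ) : ℂ)) ^ 2)) (2 * Real.pi)
  rw [abs_of_pos (by positivity), Complex.real_smul] at this
  rw [mul_comm (1 / (2 * Real.pi) : ℂ), mul_assoc,
    show (1 / (2 * Real.pi) : ℂ) = (((2 * Real.pi)⁻¹ : ℝ) : ℂ) by push_cast; rw [one_div], ← this,
    ← integral_const_mul, dysonRepr, Real.fourierInv_eq']
  refine integral_congr_ae (Eventually.of_forall fun ξ => ?_)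
  simp only [smul_eq_mul, freeSymbol]
  rw [← mul_assoc, ← Complex.exp_add, mul_comm (amplitudeW _ _ _ _ _ _), ← mul_assoc,
    ← Complex.exp_add]
  congr 2
  simp only [RCLike.inner_apply, conj_trivial]
  push_cast
  field_simp
  ring

end SecondDysonTerm

/-! ### Asymptotics of the second term and conclusion. -/

theorem norm_dysonRepr_sub_le {v u : ℝ → ℂ} {a b p₁ p₂ δ D t : ℝ} (hL : 0 ≤ (p₂ - p₁) + (b - a))
    (h0 : 1 / 2 ≤ δ) (h1 : δ < 1) (hv : Continuous v) (hu : ContDiff ℝ 1 u)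
    (hvs : tsupport v ⊆ Icc a b) (hus : tsupport u ⊆ Icc p₁ p₂) (ht : 0 < t)
    (hD : ∀ p, ‖deriv (amplitudeW v u a b t) p‖ ≤ D) (x : ℝ) :
    ‖dysonRepr v u a b t x - 1 / (2 * (√Real.pi : ℂ)) * Complex.exp (-Complex.I * Real.pi / 4) *
        Complex.exp (Complex.I * x ^ 2 / (4 * t)) *
        amplitudeW v u a b t (x / (2 * t)) * ((t ^ (-(1 / 2) : ℝ) : ℝ) : ℂ)‖ ≤
      constK δ ((p₂ - p₁) + (b - a)) * D * t ^ (-δ) := by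
  have hπ : 0 < √Real.pi := Real.sqrt_pos.2 Real.pi_pos
  have hD0 : 0 ≤ D := (norm_nonneg _).trans (hD 0)
  have hs : tsupport (amplitudeW v u a b t) ⊆
      Icc (p₁ + a) (p₁ + a + ((p₂ - p₁) + (b - a))) := by
    refine (tsupport_amplitudeW_subset hvs hus t).trans (Icc_subset_Icc le_rfl ?_)
    linarith
  -- θ = 2δ-1 turns the time exponent -1/2-θ/2 into -δ.
  have key := norm_integral_mul_cexp_sq_sub_le (θ := 2 * δ - 1) ht hL (by linarith) (by linarith)
    (contDiff_amplitudeW hv hu a b t) hs hD (x / (2 * t))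
  have hsq : √(Real.pi / t) = √Real.pi * t ^ (-(1 / 2) : ℝ) := by
    rw [Real.sqrt_div Real.pi_pos.le, Real.rpow_neg ht.le, ← Real.sqrt_eq_rpow, div_eq_mul_inv]
  have e : dysonRepr v u a b t x - 1 / (2 * (√Real.pi : ℂ)) *
      Complex.exp (-Complex.I * Real.pi / 4) * Complex.exp (Complex.I * x ^ 2 / (4 * t)) *
        amplitudeW v u a b t (x / (2 * t)) * ((t ^ (-(1 / 2) : ℝ) : ℝ) : ℂ) =
      1 / (2 * Real.pi) * Complex.exp (Complex.I * x ^ 2 / (4 * t)) *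
      ((∫ p, amplitudeW v u a b t p *
        Complex.exp (-Complex.I * t * (p - ((x / (2 * t) : ℝ) : ℂ)) ^ 2)) -
        eighthRoot⁻¹ * √(Real.pi / t) * amplitudeW v u a b t (x / (2 * t))) := by
    have hc : (1 / (2 * (√Real.pi : ℂ)) : ℂ) = 1 / (2 * Real.pi) * √Real.pi := by
      have h : ((√Real.pi : ℝ) : ℂ) ^ 2 = Real.pi := by
        rw [← Complex.ofReal_pow, Real.sq_sqrt Real.pi_pos.le]
      have h2 : ((√Real.pi : ℝ) : ℂ) ≠ 0 := Complex.ofReal_ne_zero.2 hπ.ne'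
      rw [← h]
      field_simp
    rw [dysonRepr_eq_integral v u a b ht.ne' x, hsq, hc, inv_eighthRoot, Complex.ofReal_mul]
    ring
  have hexp : ‖Complex.exp (Complex.I * x ^ 2 / (4 * t))‖ = 1 := by
    rw [show Complex.I * x ^ 2 / (4 * t) = ((x ^ 2 / (4 * t) : ℝ) : ℂ) * Complex.I by
      push_cast; ring, Complex.norm_exp_ofReal_mul_I]
  have h2π : ‖(1 / (2 * Real.pi) : ℂ)‖ = 1 / (2 * Real.pi) := by
    rw [norm_div, norm_mul, Complex.norm_real, Real.norm_of_nonneg Real.pi_pos.le]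
    simp
  rw [e, norm_mul, norm_mul, hexp, h2π, mul_one]
  have hK := stationary_constant_le h0 h1 hL
  have ht' : 0 ≤ t ^ (-δ) := by positivity
  rw [show (-(1 / 2) - (2 * δ - 1) / 2 : ℝ) = -δ by ring] at key
  calc _ ≤ 1 / (2 * Real.pi) * (D * t ^ (-δ) * (2 * Real.pi *
        constK δ ((p₂ - p₁) + (b - a)))) := by
        gcongr
        refine (key.trans_eq ?_).trans (mul_le_mul_of_nonneg_left hK (mul_nonneg hD0 ht'))
        ring
    _ = _ := by
        have := Real.pi_ne_zero
        field_simp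

theorem theorem6p4
    (k l : ℕ) (hk : 5 ≤ k) (hl : 4 ≤ l)
    (p₁ p₂ a b : ℝ) (hp : p₁ < p₂) (hab : a < b)
    (u₀ V : L2R) (uhat Vhat : ℝ → ℂ)
    (hu₀ : InH3 u₀)
    (hI : InFrequencyBand k p₁ p₂ u₀ uhat)
    (hP : InFrequencyBand l a b V Vhat)
    (h0 : (0 : ℝ) ∉ Set.Icc p₁ p₂)
    (δ₁ : ℝ) (hδ₁ : δ₁ ∈ Set.Ioo (1 / 2 : ℝ) 1)
    (δ₂ : ℝ) (hδ₂ : δ₂ ∈ Set.Ioo (2 : ℝ) (5 / 2)) :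
    0 < constC1 δ₁ δ₂ a b p₁ p₂ ∧ 0 < constC2 δ₁ δ₂ a b p₁ p₂ ∧
    -- the support of the amplitude
    (∀ t : ℝ, 0 ≤ t → tsupport (amplitudeW Vhat uhat a b t) ⊆ Set.Icc (p₁ + a) (p₂ + b)) ∧
    -- the integral defining `S₂(t) u₀` exists
    (∀ t : ℝ, 0 ≤ t →
      IntervalIntegrable (S2Integrand V u₀ t) MeasureTheory.volume 0 t) ∧
    -- the uniform estimate in the whole space
    (∀ t : ℝ, 1 ≤ t →
      MeasureTheory.eLpNorm (S2 V u₀ t) ⊤ MeasureTheory.volume ≤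
        ENNReal.ofReal (constC1 δ₁ δ₂ a b p₁ p₂ * sobolevInftyNorm 4 Vhat *
          sobolevInftyNorm 5 uhat * t ^ (-(1 / 2) : ℝ))) ∧
    -- the estimates for the continuous representative `s t` of `S₂(t) u₀`
    ∃ s : ℝ → ℝ → ℂ,
      (∀ t : ℝ, 0 ≤ t → Continuous (s t) ∧ s t =ᵐ[MeasureTheory.volume] S2 V u₀ t) ∧
      (∀ t x : ℝ, (t, x) ∈ cone (p₁ + a) (p₂ + b) →
        ‖s t x - 1 / (2 * (√Real.pi : ℂ)) * Complex.exp (-Complex.I * Real.pi / 4) *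
            Complex.exp (Complex.I * x ^ 2 / (4 * t)) *
            amplitudeW Vhat uhat a b t (x / (2 * t)) * ((t ^ (-(1 / 2) : ℝ) : ℝ) : ℂ)‖ ≤
          constC2 δ₁ δ₂ a b p₁ p₂ * sobolevInftyNorm 4 Vhat * sobolevInftyNorm 5 uhat *
            t ^ (-δ₁)) ∧
      (∀ t x : ℝ, (t, x) ∈ coneCompl (p₁ + a) (p₂ + b) →
        ‖s t x‖ ≤
          constC2 δ₁ δ₂ a b p₁ p₂ * sobolevInftyNorm 4 Vhat * sobolevInftyNorm 5 uhat *
            t ^ (-δ₁)) := by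
  obtain ⟨hδ₁l, hδ₁r⟩ := hδ₁
  obtain ⟨hδ₂l, hδ₂r⟩ := hδ₂
  have hL : 0 < (p₂ - p₁) + (b - a) := by linarith
  have hK := constK_pos hδ₁r hL
  have hM1 := constM1_pos hab hδ₂l hδ₂r
  have hM2 := constM2_pos hab hδ₂l hδ₂r
  have hπ : 0 < √Real.pi := Real.sqrt_pos.2 Real.pi_pos
  have hvs := hP.support_subset
  have hus := hI.support_subset
  have hv4 : ContDiff ℝ 4 Vhat := hP.contDiff.of_le (by exact_mod_cast hl)
  have hu5 : ContDiff ℝ 5 uhat := hI.contDiff.of_le (by exact_mod_cast hk)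
  have hu4 : ContDiff ℝ 4 uhat := hu5.of_le (by norm_num)
  have hu1 : ContDiff ℝ 1 uhat := hu5.of_le (by norm_num)
  have hvb := norm_iteratedDeriv_le_sobolevInftyNorm hP.contDiff
    (isCompact_Icc.of_isClosed_subset (isClosed_tsupport _) hvs) hl
  have hub := norm_iteratedDeriv_le_sobolevInftyNorm hI.contDiff
    (isCompact_Icc.of_isClosed_subset (isClosed_tsupport _) hus) hk
  have hF := sobolevInftyNorm_nonneg 4 Vhat
  have hG := sobolevInftyNorm_nonneg 5 uhat
  have hW : ∀ t : ℝ, 0 ≤ t → ∀ p : ℝ, _ := fun t ht p => norm_amplitudeW_le hab.le h0 hδ₂l hδ₂r hv4 hu4 hvs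
    hus hF hG hvb (fun j hj x => hub j (by omega) x) ht p
  have hW' : ∀ t : ℝ, 0 ≤ t → ∀ p : ℝ, _ := fun t ht p => norm_deriv_amplitudeW_le hab.le h0 hδ₂l hδ₂r hv4
    hu5 hvs hus hF hG hvb hub ht p
  set F := sobolevInftyNorm 4 Vhat
  set G := sobolevInftyNorm 5 uhat
  have hFG : 0 ≤ F * G := mul_nonneg hF hG
  have hae : ∀ t, dysonRepr Vhat uhat a b t =ᵐ[volume] S2 V u₀ t := fun t =>
    dysonRepr_ae_eq hab.le hP.ae_eq_hat hI.ae_eq_hat hv4.continuous hu1 hvs hus t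
  -- Valid for every x, inside the cone or not; all three estimates follow from it.
  have hasymp : ∀ t x : ℝ, 0 < t → _ := fun t x ht => norm_dysonRepr_sub_le hL.le hδ₁l.le hδ₁r
    hv4.continuous hu1 hvs hus ht (hW' t ht.le) x
  have hC2 : ∀ t : ℝ, constK δ₁ ((p₂ - p₁) + (b - a)) * (constM2 δ₂ a b * (F * G)) * t ^ (-δ₁) =
      constC2 δ₁ δ₂ a b p₁ p₂ * F * G * t ^ (-δ₁) := fun t => by
    rw [constC2]
    ring
  have hnorm : ∀ t x : ℝ, 0 < t → ‖1 / (2 * (√Real.pi : ℂ)) *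
      Complex.exp (-Complex.I * Real.pi / 4) * Complex.exp (Complex.I * x ^ 2 / (4 * t)) *
        amplitudeW Vhat uhat a b t (x / (2 * t)) * ((t ^ (-(1 / 2) : ℝ) : ℝ) : ℂ)‖ =
      1 / (2 * √Real.pi) * ‖amplitudeW Vhat uhat a b t (x / (2 * t))‖ * t ^ (-(1 / 2) : ℝ) := by
    intro t x ht
    have hexp : ‖Complex.exp (Complex.I * x ^ 2 / (4 * t))‖ = 1 := by
      rw [show Complex.I * x ^ 2 / (4 * t) = ((x ^ 2 / (4 * t) : ℝ) : ℂ) * Complex.I by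
        push_cast; ring, Complex.norm_exp_ofReal_mul_I]
    have hc : ‖(1 / (2 * (√Real.pi : ℂ)) : ℂ)‖ = 1 / (2 * √Real.pi) := by
      rw [norm_div, norm_mul, Complex.norm_real, Real.norm_of_nonneg hπ.le]
      simp
    rw [norm_mul, norm_mul, norm_mul, norm_mul, hexp, hc, ← inv_eighthRoot, norm_inv,
      norm_eighthRoot, Complex.norm_real, Real.norm_of_nonneg (by positivity)]
    ring
  refine ⟨by unfold constC1; positivity, by unfold constC2; positivity,
    fun t _ => tsupport_amplitudeW_subset hvs hus t,
    fun t _ => (continuous_S2Integrand hab.le hP.ae_eq_hat hI.ae_eq_hat hv4.continuous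
      hu1.continuous hvs hus t).intervalIntegrable 0 t, fun t ht => ?_,
    dysonRepr Vhat uhat a b, fun t _ => ⟨continuous_dysonRepr hv4.continuous hu1 hvs hus t, hae t⟩,
    fun t x hx => (hasymp t x hx.1).trans_eq (hC2 t), fun t x hx => ?_⟩
  · have ht0 : 0 < t := by linarith
    rw [eLpNorm_exponent_top]
    refine eLpNormEssSup_le_of_ae_bound ?_
    filter_upwards [hae t] with x hx
    rw [← hx]
    have h1 := hasymp t x ht0
    have h2 := hnorm t x ht0
    have h3 := hW t ht0.le (x / (2 * t))
    have h4 : t ^ (-δ₁) ≤ t ^ (-(1 / 2) : ℝ) := Real.rpow_le_rpow_of_exponent_le ht (by linarith)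
    have h5 := norm_le_norm_sub_add (dysonRepr Vhat uhat a b t x) (1 / (2 * (√Real.pi : ℂ)) *
      Complex.exp (-Complex.I * Real.pi / 4) * Complex.exp (Complex.I * x ^ 2 / (4 * t)) *
        amplitudeW Vhat uhat a b t (x / (2 * t)) * ((t ^ (-(1 / 2) : ℝ) : ℝ) : ℂ))
    have hT : 0 ≤ t ^ (-(1 / 2) : ℝ) := by positivity
    have h6 : 0 ≤ 1 / (2 * √Real.pi) := by positivity
    calc _ ≤ _ := h5
      _ ≤ constK δ₁ ((p₂ - p₁) + (b - a)) * (constM2 δ₂ a b * (F * G)) * t ^ (-(1 / 2) : ℝ) +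
          1 / (2 * √Real.pi) * (constM1 δ₂ a b * (F * G)) * t ^ (-(1 / 2) : ℝ) := by
          rw [h2]
          refine add_le_add (h1.trans ?_) ?_ <;> gcongr
      -- Enlarging both M₁ and M₂ to M₁ + M₂ lets the two terms combine into c₁.
      _ ≤ (constK δ₁ ((p₂ - p₁) + (b - a)) * ((constM1 δ₂ a b + constM2 δ₂ a b) * (F * G))) *
            t ^ (-(1 / 2) : ℝ) +
          1 / (2 * √Real.pi) * ((constM1 δ₂ a b + constM2 δ₂ a b) * (F * G)) *
            t ^ (-(1 / 2) : ℝ) := by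
          gcongr <;> linarith
      _ = _ := by rw [constC1]; ring
  · obtain ⟨ht : 0 < t, hx⟩ := hx
    -- Outside the cone the stationary point misses the support of the amplitude, so the leading
    -- term vanishes.
    have hW0 : amplitudeW Vhat uhat a b t (x / (2 * t)) = 0 := by
      by_contra h
      have := tsupport_amplitudeW_subset hvs hus t (subset_tsupport _ h)
      have e : x / t = 2 * (x / (2 * t)) := by field_simp
      exact hx ⟨ht, by simp only [e]; linarith [this.1], by simp only [e]; linarith [this.2]⟩
    have := hasymp t x ht
    rw [hC2] at this
    rw [hW0] at this
    simpa using this
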